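/- Let $M$ be a complex manifold of complex dimension $m\ge 2$, so that its real dimension is $n=2m\geq 4$, let $J$ be its complex structure, and let $h$ be a Hermitian metric on $M$, that is, a $J$-invariant Riemannian metric. Suppose that there is an atlas of real coordinate charts on $M$ which is $C^2$-compatible with the complex atlas and in which $h$ is of class $C^3$, and suppose that the Ricci tensor $r$ of $h$ (computed in these charts) is $J$-invariant: $r(J\cdot,J\cdot)=r$. Let $f:M\to[0,\infty)$ be a continuous function, let $Z=f^{-1}(0)$, and let $Y=M\setminus Z$. Suppose that $f$ is of class $C^2$ on $Y$ relative to the complex atlas, and that $g=f^2h$ is a Kähler metric on $Y$, i.e. that its fundamental form $\omega_g=g(J\cdot,\cdot)$ satisfies $d\omega_g=0$ on $Y$. Suppose finally that $Z$ has Hausdorff dimension $<n-1$. Then $Z=\varnothing$, $f$ is everywhere positive, and $(M,J,h)$ is globally conformally Kähler: there is a positive $C^2$ function $u$ on $M$ such that $u^2h$ is a Kähler metric on $M$. -/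

import Mathlib

open scoped Manifold ContDiff

set_option maxSynthPendingDepth 3

noncomputable section

namespace HermitianGeometry

section Coordinates

variable {E : Type*} [NormedAddCommGroup E] [NormedSpace ℝ E]

/-- The Christoffel symbols `Γ(y)(v, w)` of a metric `G` given in linear coordinates on an open
subset of `E`: the vector such that for all `z`
`2 G(y)(Γ(y)(v, w), z) = (∂_v G)(w, z) + (∂_w G)(v, z) - (∂_z G)(v, w)`. -/
def christoffel (G : E → E →L[ℝ] E →L[ℝ] ℝ) (y : E) : E →L[ℝ] E →L[ℝ] E :=
  let D : E →L[ℝ] E →L[ℝ] E →L[ℝ] ℝ := fderiv ℝ G y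
  (ContinuousLinearMap.compL ℝ E (E →L[ℝ] ℝ) E (G y).inverse).comp
    ((1 / 2 : ℝ) • (D + D.flip -
      (ContinuousLinearMap.flipₗᵢ ℝ E E ℝ).toContinuousLinearEquiv.toContinuousLinearMap.comp
        D.flip))

/-- The curvature endomorphism `u ↦ R(u, v) w` at `y` of the Levi-Civita connection of `G`, where
`R(u, v) w = (∂_u Γ)(v, w) - (∂_v Γ)(u, w) + Γ(u, Γ(v, w)) - Γ(v, Γ(u, w))`. -/
def curvatureEnd (G : E → E →L[ℝ] E →L[ℝ] ℝ) (y v w : E) : E →L[ℝ] E :=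
  let Γ : E →L[ℝ] E →L[ℝ] E := christoffel G y
  let DΓ : E →L[ℝ] E →L[ℝ] E →L[ℝ] E := fderiv ℝ (christoffel G) y
  (DΓ.flip v).flip w - (DΓ v).flip w + Γ.flip (Γ v w) - (Γ v).comp (Γ.flip w)

/-- The Ricci tensor `Ric(v, w) = tr (u ↦ R(u, v) w)` at `y` of a metric `G` given in linear
coordinates. -/
def coordRicci (G : E → E →L[ℝ] E →L[ℝ] ℝ) (y v w : E) : ℝ :=
  LinearMap.trace ℝ E (curvatureEnd G y v w : E →ₗ[ℝ] E)

/-- The exterior derivative of a `2`-form `σ` given in linear coordinates. -/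
def coordExtDeriv (σ : E → E →L[ℝ] E →L[ℝ] ℝ) (y u v w : E) : ℝ :=
  fderiv ℝ σ y u v w + fderiv ℝ σ y v w u + fderiv ℝ σ y w u v

end Coordinates

section Manifold

variable {E : Type*} [NormedAddCommGroup E] [NormedSpace ℂ E]
  {M : Type*} [TopologicalSpace M] [ChartedSpace E M]

/-- The complex structure `J` of the real tangent space at `x` of a complex manifold modelled on
`E`. The tangent space is `E`, read in the preferred holomorphic chart at `x`, and `J` is
multiplication by `i`. -/
def complexStructure (x : M) :
    TangentSpace 𝓘(ℝ, E) x →L[ℝ] TangentSpace 𝓘(ℝ, E) x :=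
  (Complex.I • ContinuousLinearMap.id ℝ E : E →L[ℝ] E)

variable (E M) in
/-- Fields (with no regularity) of real bilinear forms on the tangent spaces of `M`. -/
abbrev BilinField : Type _ :=
  ∀ x : M, TangentSpace 𝓘(ℝ, E) x →L[ℝ] TangentSpace 𝓘(ℝ, E) x →L[ℝ] ℝ

/-- The coordinate expression of a field of bilinear forms in a chart `φ`, that is, its pull-back
under `φ⁻¹`. It is meaningful on `φ.target`. -/
def inChart (φ : OpenPartialHomeomorph M E) (b : BilinField E M) (y : E) :
    E →L[ℝ] E →L[ℝ] ℝ :=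
  let A : E →L[ℝ] E := mfderiv 𝓘(ℝ, E) 𝓘(ℝ, E) φ.symm y
  let B : E →L[ℝ] E →L[ℝ] ℝ := b (φ.symm y)
  B.bilinearComp A A

/-- The Ricci tensor at `x` of the metric `h`, computed in the chart `φ`. -/
def ricci (φ : OpenPartialHomeomorph M E) (h : BilinField E M) (x : M)
    (v w : TangentSpace 𝓘(ℝ, E) x) : ℝ :=
  let A : TangentSpace 𝓘(ℝ, E) x →L[ℝ] E := mfderiv 𝓘(ℝ, E) 𝓘(ℝ, E) φ x
  coordRicci (inChart φ h) (φ x) (A v) (A w)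

/-- The field `b` is invariant under `J` on `U`. -/
def IsJInvariantOn (b : BilinField E M) (U : Set M) : Prop :=
  ∀ x ∈ U, ∀ v w : TangentSpace 𝓘(ℝ, E) x,
    b x (complexStructure x v) (complexStructure x w) = b x v w

/-- The fundamental form `ω = g(J·, ·)`. -/
def fundamentalForm (g : BilinField E M) : BilinField E M :=
  fun x ↦ (g x).comp (complexStructure x)

/-- `g` is a Kähler metric on the open set `U`: it is a `J`-invariant Riemannian metric, of class
`C¹` in the holomorphic charts, whose fundamental form is closed. -/
structure IsKahlerOn (g : BilinField E M) (U : Set M) : Prop where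
  symm : ∀ x ∈ U, ∀ v w : TangentSpace 𝓘(ℝ, E) x, g x v w = g x w v
  pos : ∀ x ∈ U, ∀ v : TangentSpace 𝓘(ℝ, E) x, v ≠ 0 → 0 < g x v v
  invariant : IsJInvariantOn g U
  contDiffOn : ∀ φ ∈ atlas E M, ContDiffOn ℝ 1 (inChart φ g) (φ.target ∩ φ.symm ⁻¹' U)
  closed : ∀ φ ∈ atlas E M, ∀ y ∈ φ.target ∩ φ.symm ⁻¹' U, ∀ u v w : E,
    coordExtDeriv (inChart φ (fundamentalForm g)) y u v w = 0

/-- The metric `f² h`. -/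
def conformalChange (f : M → ℝ) (h : BilinField E M) : BilinField E M :=
  fun x ↦ (f x ^ 2) • h x

/-- `h` is globally conformally Kähler: some positive `C²` function `u` on all of `M` makes
`u² h` a Kähler metric on `M`. -/
def IsGloballyConformallyKahler (h : BilinField E M) : Prop :=
  ∃ u : M → ℝ, (∀ x, 0 < u x) ∧ ContMDiff 𝓘(ℝ, E) 𝓘(ℝ, ℝ) 2 u ∧
    IsKahlerOn (conformalChange u h) Set.univ

variable (E) in
/-- The Hausdorff dimension of a subset of a manifold, that is, the supremum of the Hausdorff
dimensions of its pieces read in the charts of the atlas. -/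
def hausdorffDim (Z : Set M) : ENNReal :=
  ⨆ φ ∈ atlas E M, dimH (φ '' (φ.source ∩ Z))

/-- `𝓑` is an atlas of real coordinates on `M` that is `C²`-compatible with the complex atlas: its
charts cover `M`, and all changes of coordinates from or to a complex chart are `C²`. -/
structure IsC2CompatibleAtlas (𝓑 : Set (OpenPartialHomeomorph M E)) : Prop where
  compatible : 𝓑 ⊆ IsManifold.maximalAtlas 𝓘(ℝ, E) 2 M
  covers : ∀ x : M, ∃ φ ∈ 𝓑, x ∈ φ.source

end Manifold

end HermitianGeometry

end

/-!
The point is that `f` has no zeros; then `u = f` is the required conformal factor.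

Let `n` be the real dimension, `Y = {f ≠ 0}` and `g = f² h`. Everything happens in a real coordinate
chart in which `h` is regular, where the complex structure `J` is a field of endomorphisms of class
`C¹`.

* On `Y` the metric `g` is Kähler, so `J` is parallel for its Levi-Civita connection. This is checked
  in a holomorphic chart (`christoffel_mulI`) and carried over to the real chart
  (`fderiv_complexStructure_eq`). Consequently `∂J` is differentiable, the curvature of `g` commutes
  with `J`, and the Ricci tensor of `g` is `J`-invariant (`coordRicci_invariant_of_parallel`).
* By the formula for the Ricci tensor of a conformal metric (`coordRicci_conformal`), and since
  `n ≠ 2`, the Hessian of `1 / f` with respect to `h` is `J`-invariant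
  (`conformalHessian_invariant`). Together with the parallelism of `J` for `g`, this says that
  `J grad (1 / f)` is a Killing field of `h` on `Y`; its dual `1`-form is `killingForm`, and the
  Killing equation is `killingForm_killing`.
* A Killing form `κ` and its derivative satisfy a closed linear system of differential equations
  along segments, whose coefficients only involve the connection of `h` and its first derivative.
  Here `κ` is only known to be `C¹`; that its first jet is differentiable is a regularity statement
  for `1`-forms with a `C¹` symmetrised derivative (`hasFDerivAt_fderiv_of_symmetrised`), proved by
  mean value estimates for second differences. Grönwall's inequality then bounds `κ` along any
  segment contained in `Y` by its first jet at one end (`norm_le_of_killing_segment`).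
* The zero set `Z` has Hausdorff dimension `< n - 1`, so a point of `Y` close to a zero `p` is joined
  to points of a fixed small ball in `Y` by segments contained in `Y` (`exists_segment_avoiding`).
  Hence `κ`, and with it the differential of `1 / f`, is bounded on these segments, and `1 / f` is
  bounded on `Y` near `p`. As `Y` is dense and `f p = 0`, this is absurd (`ne_zero_of_parallel`).
-/

namespace HermitianGeometry

/-! ### Inner products and Christoffel symbols -/

section Metric

variable {E : Type*} [NormedAddCommGroup E] [NormedSpace ℝ E]

/-- A continuous bilinear form which is an inner product: symmetric and positive definite. -/
structure IsInner (B : E →L[ℝ] E →L[ℝ] ℝ) : Prop where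
  symm : ∀ v w, B v w = B w v
  pos : ∀ v, v ≠ 0 → 0 < B v v

theorem IsInner.ext {B : E →L[ℝ] E →L[ℝ] ℝ} (hB : IsInner B) {v w : E}
    (h : ∀ z, B v z = B w z) : v = w := by
  by_contra hne
  have h1 := hB.pos (v - w) (sub_ne_zero.2 hne)
  have h2 := h (v - w)
  simp only [map_sub, sub_apply] at h1 h2
  linarith

theorem IsInner.isInvertible [FiniteDimensional ℝ E] {B : E →L[ℝ] E →L[ℝ] ℝ} (hB : IsInner B) :
    B.IsInvertible := by
  have hinj : Function.Injective (B : E →ₗ[ℝ] E →L[ℝ] ℝ) := by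
    intro v w hvw
    exact hB.ext fun z => congrArg (fun L : E →L[ℝ] ℝ => L z) hvw
  have hrank : Module.finrank ℝ E = Module.finrank ℝ (E →L[ℝ] ℝ) := by
    rw [← (LinearMap.toContinuousLinearMap (𝕜 := ℝ) (E := E) (F' := ℝ)).finrank_eq]
    exact (Subspace.dual_finrank_eq (K := ℝ) (V := E)).symm
  refine ⟨(LinearEquiv.ofInjectiveOfFinrankEq (B : E →ₗ[ℝ] E →L[ℝ] ℝ) hinj
    hrank).toContinuousLinearEquiv, ?_⟩
  ext v w
  rfl

theorem IsInner.apply_inverse [FiniteDimensional ℝ E] {B : E →L[ℝ] E →L[ℝ] ℝ} (hB : IsInner B)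
    (α : E →L[ℝ] ℝ) : B (B.inverse α) = α :=
  hB.isInvertible.self_apply_inverse α

theorem contDiffAt_clm_inverse [CompleteSpace E] {F X : Type*} [NormedAddCommGroup F]
    [NormedSpace ℝ F] [NormedAddCommGroup X] [NormedSpace ℝ X] {n : ℕ∞ω} {A : X → E →L[ℝ] F}
    {x : X} (hA : ContDiffAt ℝ n A x) (hx : (A x).IsInvertible) :
    ContDiffAt ℝ n (fun y => (A y).inverse) x := by
  obtain ⟨e, he⟩ := hx
  have := contDiffAt_map_inverse (n := n) e
  rw [he] at this
  exact this.comp x hA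

theorem christoffel_spec [FiniteDimensional ℝ E] {G : E → E →L[ℝ] E →L[ℝ] ℝ} {y : E}
    (hG : IsInner (G y)) (v w z : E) :
    2 * G y (christoffel G y v w) z =
      fderiv ℝ G y v w z + fderiv ℝ G y w v z - fderiv ℝ G y z v w := by
  have : G y (christoffel G y v w) z = (1 / 2 : ℝ) *
      (fderiv ℝ G y v w z + fderiv ℝ G y w v z - fderiv ℝ G y z v w) := by
    simp only [christoffel, ContinuousLinearMap.comp_apply, ContinuousLinearMap.compL_apply]
    rw [hG.apply_inverse]
    simp
  rw [this]; ring

theorem fderiv_symm {G : E → E →L[ℝ] E →L[ℝ] ℝ} {y : E} (hd : DifferentiableAt ℝ G y)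
    (hs : ∀ᶠ x in nhds y, ∀ v w, G x v w = G x w v) (u v w : E) :
    fderiv ℝ G y u v w = fderiv ℝ G y u w v := by
  have h1 : HasFDerivAt (fun x => G x v w) _ y :=
    (hd.hasFDerivAt.clm_apply (hasFDerivAt_const v y)).clm_apply (hasFDerivAt_const w y)
  have h2 : HasFDerivAt (fun x => G x w v) _ y :=
    (hd.hasFDerivAt.clm_apply (hasFDerivAt_const w y)).clm_apply (hasFDerivAt_const v y)
  have h3 := h1.unique (h2.congr_of_eventuallyEq (hs.mono fun x hx => hx v w))
  simpa using congrArg (fun L : E →L[ℝ] ℝ => L u) h3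

/-- A torsion-free metric connection is the Levi-Civita connection. -/
theorem eq_christoffel [FiniteDimensional ℝ E] {G : E → E →L[ℝ] E →L[ℝ] ℝ} {y : E}
    (hG : IsInner (G y)) {T : E → E → E} (hT : ∀ v w, T v w = T w v)
    (hm : ∀ u v w, fderiv ℝ G y u v w = G y (T u v) w + G y v (T u w)) (v w : E) :
    christoffel G y v w = T v w := by
  refine hG.ext fun z => ?_
  have h := christoffel_spec hG v w z
  rw [hm, hm, hm, hT w v, hT z v, hT z w, hG.symm w, hG.symm v (T w z)] at h
  linarith

theorem christoffel_symm [FiniteDimensional ℝ E] {G : E → E →L[ℝ] E →L[ℝ] ℝ} {y : E}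
    (hG : IsInner (G y)) (hd : DifferentiableAt ℝ G y)
    (hs : ∀ᶠ x in nhds y, ∀ v w, G x v w = G x w v) (v w : E) :
    christoffel G y v w = christoffel G y w v := by
  refine hG.ext fun z => ?_
  have h1 := christoffel_spec hG v w z
  have h2 := christoffel_spec hG w v z
  have h3 := fderiv_symm hd hs z v w
  linarith

theorem fderiv_eq_christoffel [FiniteDimensional ℝ E] {G : E → E →L[ℝ] E →L[ℝ] ℝ} {y : E}
    (hG : IsInner (G y)) (hd : DifferentiableAt ℝ G y)
    (hs : ∀ᶠ x in nhds y, ∀ v w, G x v w = G x w v) (u v w : E) :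
    fderiv ℝ G y u v w = G y (christoffel G y u v) w + G y v (christoffel G y u w) := by
  have h1 := christoffel_spec hG u v w
  have h2 := christoffel_spec hG u w v
  rw [hG.symm v]
  have h3 := fderiv_symm hd hs u v w
  have h4 := fderiv_symm hd hs v u w
  have h5 := fderiv_symm hd hs w u v
  linarith

theorem contDiffAt_christoffel [FiniteDimensional ℝ E] {G : E → E →L[ℝ] E →L[ℝ] ℝ} {y : E}
    {m n : ℕ∞ω} (hG : IsInner (G y)) (hd : ContDiffAt ℝ n G y) (hmn : m + 1 ≤ n) :
    ContDiffAt ℝ m (christoffel G) y := by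
  have hD : ContDiffAt ℝ m (fderiv ℝ G) y := hd.fderiv_right hmn
  have hI : ContDiffAt ℝ m (fun x => (G x).inverse) y :=
    contDiffAt_clm_inverse (hd.of_le (le_trans le_self_add hmn)) hG.isInvertible
  unfold HermitianGeometry.christoffel
  simp only []
  have hflip : ContDiffAt ℝ m (fun x => (fderiv ℝ G x).flip) y :=
    (ContinuousLinearMap.flipₗᵢ ℝ E E (E →L[ℝ] ℝ)).toContinuousLinearEquiv.contDiff.contDiffAt.comp
      y hD
  refine ContDiffAt.clm_comp ?_ ?_
  · exact (ContinuousLinearMap.compL ℝ E (E →L[ℝ] ℝ) E).contDiff.contDiffAt.comp y hI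
  · exact ((hD.add hflip).sub (contDiffAt_const.clm_comp hflip)).const_smul _

end Metric

/-! ### Curvature and the Ricci tensor of a Kähler metric -/

section Curvature

variable {E : Type*} [NormedAddCommGroup E] [NormedSpace ℝ E]

theorem curvatureEnd_apply (G : E → E →L[ℝ] E →L[ℝ] ℝ) (y u v w : E) :
    curvatureEnd G y v w u =
      fderiv ℝ (christoffel G) y u v w - fderiv ℝ (christoffel G) y v u w
        + christoffel G y u (christoffel G y v w) - christoffel G y v (christoffel G y u w) := by
  simp [curvatureEnd]

theorem curvatureEnd_antisymm (G : E → E →L[ℝ] E →L[ℝ] ℝ) (y u v w : E) :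
    curvatureEnd G y v w u = - curvatureEnd G y u w v := by
  simp only [curvatureEnd_apply]; abel

variable [FiniteDimensional ℝ E] {G : E → E →L[ℝ] E →L[ℝ] ℝ} {y : E}

theorem fderiv_christoffel_symm (hd : ContDiffAt ℝ 2 G y) (hG : ∀ᶠ x in nhds y, IsInner (G x))
    (u v w : E) :
    fderiv ℝ (christoffel G) y u v w = fderiv ℝ (christoffel G) y u w v := by
  have hΓ : DifferentiableAt ℝ (christoffel G) y :=
    (contDiffAt_christoffel (m := 1) hG.self_of_nhds hd (by norm_num)).differentiableAt (by simp)
  have h1 : HasFDerivAt (fun x => christoffel G x v w) _ y :=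
    (hΓ.hasFDerivAt.clm_apply (hasFDerivAt_const v y)).clm_apply (hasFDerivAt_const w y)
  have h2 : HasFDerivAt (fun x => christoffel G x w v) _ y :=
    (hΓ.hasFDerivAt.clm_apply (hasFDerivAt_const w y)).clm_apply (hasFDerivAt_const v y)
  have hev : (fun x => christoffel G x v w) =ᶠ[nhds y] fun x => christoffel G x w v := by
    filter_upwards [hG.eventually_nhds, hd.eventually (by simp)] with x hx hdx
    exact christoffel_symm hx.self_of_nhds (hdx.differentiableAt (by simp))
      (hx.mono fun z hz => hz.symm) v w
  have h3 := h1.unique (h2.congr_of_eventuallyEq hev)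
  simpa using congrArg (fun L : E →L[ℝ] E => L u) h3

/-- The first Bianchi identity. -/
theorem curvatureEnd_bianchi (hd : ContDiffAt ℝ 2 G y) (hG : ∀ᶠ x in nhds y, IsInner (G x))
    (u v w : E) :
    curvatureEnd G y v w u + curvatureEnd G y w u v + curvatureEnd G y u v w = 0 := by
  have hs := christoffel_symm hG.self_of_nhds (hd.differentiableAt (by simp))
      (hG.mono fun z hz => hz.symm)
  have hs' := fderiv_christoffel_symm hd hG
  simp only [curvatureEnd_apply]
  rw [hs v w, hs u w, hs u v, hs' v u w, hs' u v w, hs' w v u]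
  abel

/-- The curvature of the Levi-Civita connection takes values in skew endomorphisms. -/
theorem curvatureEnd_skew_self (hd : ContDiffAt ℝ 2 G y) (hG : ∀ᶠ x in nhds y, IsInner (G x))
    (u v w : E) : G y (curvatureEnd G y v w u) w = 0 := by
  have hs : ∀ᶠ x in nhds y, ∀ v w, G x v w = G x w v := hG.mono fun z hz => hz.symm
  have hsy := hG.self_of_nhds.symm
  have hdG : DifferentiableAt ℝ G y := hd.differentiableAt (by simp)
  have hΓ : DifferentiableAt ℝ (christoffel G) y :=
    (contDiffAt_christoffel (m := 1) hG.self_of_nhds hd (by norm_num)).differentiableAt (by simp)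
  have hDD : DifferentiableAt ℝ (fderiv ℝ G) y :=
    (hd.fderiv_right (m := 1) (by norm_num)).differentiableAt (by simp)
  -- Differentiating `∂_b G (w, w) = 2 G (Γ(b, w), w)` expresses the second derivatives of `G`.
  have key : ∀ a b, fderiv ℝ (fderiv ℝ G) y a b w w =
      2 * (fderiv ℝ G y a (christoffel G y b w) w
        + G y (fderiv ℝ (christoffel G) y a b w) w) := by
    intro a b
    have h1 : HasFDerivAt (fun x => fderiv ℝ G x b w w) _ y :=
      ((hDD.hasFDerivAt.clm_apply (hasFDerivAt_const b y)).clm_apply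
        (hasFDerivAt_const w y)).clm_apply (hasFDerivAt_const w y)
    have h2 : HasFDerivAt (fun x => 2 * G x (christoffel G x b w) w) _ y :=
      ((hdG.hasFDerivAt.clm_apply ((hΓ.hasFDerivAt.clm_apply (hasFDerivAt_const b y)).clm_apply
        (hasFDerivAt_const w y))).clm_apply (hasFDerivAt_const w y)).const_mul 2
    have hev : (fun x => fderiv ℝ G x b w w) =ᶠ[nhds y]
        fun x => 2 * G x (christoffel G x b w) w := by
      filter_upwards [hG, hs.eventually_nhds, hd.eventually (by simp)] with x hx hsx hdx
      have := fderiv_eq_christoffel hx (hdx.differentiableAt (by simp)) hsx b w w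
      rw [this, hx.symm w]; ring
    have h3 := h1.unique (h2.congr_of_eventuallyEq hev)
    have h4 := congrArg (fun L : E →L[ℝ] ℝ => L a) h3
    simp at h4
    rw [h4]; ring
  have hsym : fderiv ℝ (fderiv ℝ G) y u v = fderiv ℝ (fderiv ℝ G) y v u := by
    refine second_derivative_symmetric_of_eventually (𝕜 := ℝ) (f := G) ?_ hDD.hasFDerivAt u v
    filter_upwards [hd.eventually (by simp)] with x hx
    exact (hx.differentiableAt (by simp)).hasFDerivAt
  have k1 := key u v
  have k2 := key v u
  rw [hsym] at k1
  have e1 := fderiv_eq_christoffel hG.self_of_nhds hdG hs u (christoffel G y v w) w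
  have e2 := fderiv_eq_christoffel hG.self_of_nhds hdG hs v (christoffel G y u w) w
  have e3 := hsy (christoffel G y v w) (christoffel G y u w)
  rw [curvatureEnd_apply]
  simp only [map_sub, map_add, sub_apply, add_apply]
  linarith

theorem curvatureEnd_skew (hd : ContDiffAt ℝ 2 G y) (hG : ∀ᶠ x in nhds y, IsInner (G x))
    (u v w z : E) : G y (curvatureEnd G y v w u) z = - G y (curvatureEnd G y v z u) w := by
  have h0 := curvatureEnd_skew_self hd hG u v w
  have h1 := curvatureEnd_skew_self hd hG u v z
  have h2 := curvatureEnd_skew_self hd hG u v (w + z)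
  have hadd : curvatureEnd G y v (w + z) u = curvatureEnd G y v w u + curvatureEnd G y v z u := by
    simp only [curvatureEnd_apply, map_add]; abel
  rw [hadd] at h2
  simp only [map_add, add_apply] at h2
  linarith

/-- The pair symmetry, a linear consequence of the two skew symmetries and the Bianchi identity. -/
theorem curvatureEnd_pair_symm (hd : ContDiffAt ℝ 2 G y) (hG : ∀ᶠ x in nhds y, IsInner (G x))
    (u v w z : E) : G y (curvatureEnd G y v w u) z = G y (curvatureEnd G y z u w) v := by
  have hb : ∀ a b c d, G y (curvatureEnd G y b c a) d + G y (curvatureEnd G y c a b) d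
      + G y (curvatureEnd G y a b c) d = 0 := by
    intro a b c d
    have := curvatureEnd_bianchi hd hG a b c
    rw [← add_apply, ← map_add, ← add_apply, ← map_add, this]; simp
  have ha : ∀ a b c d, G y (curvatureEnd G y b c a) d = - G y (curvatureEnd G y a c b) d := by
    intro a b c d
    rw [curvatureEnd_antisymm]; simp
  have hk := curvatureEnd_skew hd hG
  linarith [hb u v w z, hb v w z u, hb w z u v, hb z u v w,
    ha u v w z, ha v w u z, ha w u v z, ha v w z u, ha w z v u, ha z v w u,
    ha w z u v, ha z u w v, ha u w z v, ha z u v w, ha u v z w, ha v z u w,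
    hk u v w z, hk v w u z, hk w u v z, hk w z v u, hk z v w u, hk z u w v]

/-- A complex structure which is parallel for the Levi-Civita connection commutes with the
curvature. -/
theorem curvatureEnd_comm (hd : ContDiffAt ℝ 2 G y) (hG : ∀ᶠ x in nhds y, IsInner (G x))
    {J : E → E →L[ℝ] E} (hJ : ∀ᶠ x in nhds y, DifferentiableAt ℝ J x)
    (hpar : ∀ᶠ x in nhds y, ∀ v w,
      fderiv ℝ J x v w = J x (christoffel G x v w) - christoffel G x v (J x w)) (u v w : E) :
    curvatureEnd G y v (J y w) u = J y (curvatureEnd G y v w u) := by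
  have hΓ : DifferentiableAt ℝ (christoffel G) y :=
    (contDiffAt_christoffel (m := 1) hG.self_of_nhds hd (by norm_num)).differentiableAt (by simp)
  have hJy : DifferentiableAt ℝ J y := hJ.self_of_nhds
  have hpy := hpar.self_of_nhds
  -- The right-hand side of the equation of parallelism is differentiable, hence so is `∂J`.
  let P : E → E →L[ℝ] E →L[ℝ] E := fun x =>
    (ContinuousLinearMap.compL ℝ E E E (J x)).comp (christoffel G x)
      - ((ContinuousLinearMap.compL ℝ E E E).flip (J x)).comp (christoffel G x)
  have hP : DifferentiableAt ℝ P y := by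
    refine DifferentiableAt.sub (DifferentiableAt.clm_comp ?_ hΓ) (DifferentiableAt.clm_comp ?_ hΓ)
    · exact (ContinuousLinearMap.compL ℝ E E E).differentiableAt.comp y hJy
    · exact (ContinuousLinearMap.compL ℝ E E E).flip.differentiableAt.comp y hJy
  have hPJ : fderiv ℝ J =ᶠ[nhds y] P := by
    filter_upwards [hpar] with x hx
    ext v w
    simp [P, hx]
  have hDJ : DifferentiableAt ℝ (fderiv ℝ J) y := hP.congr_of_eventuallyEq hPJ
  have hsym : fderiv ℝ (fderiv ℝ J) y u v = fderiv ℝ (fderiv ℝ J) y v u := by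
    refine second_derivative_symmetric_of_eventually (𝕜 := ℝ) (f := J) ?_ hDJ.hasFDerivAt u v
    exact hJ.mono fun x hx => hx.hasFDerivAt
  have key : ∀ a b, fderiv ℝ (fderiv ℝ J) y a b w =
      fderiv ℝ J y a (christoffel G y b w) + J y (fderiv ℝ (christoffel G) y a b w)
      - (fderiv ℝ (christoffel G) y a b (J y w) + christoffel G y b (fderiv ℝ J y a w)) := by
    intro a b
    have h1 : HasFDerivAt (fun x => fderiv ℝ J x b w) _ y :=
      (hDJ.hasFDerivAt.clm_apply (hasFDerivAt_const b y)).clm_apply (hasFDerivAt_const w y)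
    have hΓb := hΓ.hasFDerivAt.clm_apply (hasFDerivAt_const b y)
    have h2 : HasFDerivAt (fun x => J x (christoffel G x b w) - christoffel G x b (J x w)) _ y :=
      (hJy.hasFDerivAt.clm_apply (hΓb.clm_apply (hasFDerivAt_const w y))).sub
        (hΓb.clm_apply (hJy.hasFDerivAt.clm_apply (hasFDerivAt_const w y)))
    have h3 := h1.unique (h2.congr_of_eventuallyEq (hpar.mono fun x hx => hx b w))
    have h4 := congrArg (fun L : E →L[ℝ] E => L a) h3
    simp at h4
    rw [h4]; abel
  have k1 := key u v
  have k2 := key v u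
  rw [hsym, k2] at k1
  rw [hpy, hpy, hpy, hpy] at k1
  rw [curvatureEnd_apply, curvatureEnd_apply]
  simp only [map_sub, map_add] at k1 ⊢
  rw [← sub_eq_zero] at k1 ⊢
  rw [← k1]; abel

/-- The Ricci tensor of a Kähler metric is invariant under the complex structure. Since the curvature
commutes with `J`, pair symmetry gives `R(Ju, Jv) = R(u, v)`, and the trace is cyclic. -/
theorem coordRicci_invariant_of_parallel (hd : ContDiffAt ℝ 2 G y)
    (hG : ∀ᶠ x in nhds y, IsInner (G x)) {J : E → E →L[ℝ] E}
    (hJ : ∀ᶠ x in nhds y, DifferentiableAt ℝ J x)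
    (hinv : ∀ v w, G y (J y v) (J y w) = G y v w)
    (hpar : ∀ᶠ x in nhds y, ∀ v w,
      fderiv ℝ J x v w = J x (christoffel G x v w) - christoffel G x v (J x w)) (v w : E) :
    coordRicci G y (J y v) (J y w) = coordRicci G y v w := by
  have hc := curvatureEnd_comm hd hG hJ hpar
  have hJJ : ∀ a b c, curvatureEnd G y (J y b) c (J y a) = curvatureEnd G y b c a := by
    intro a b c
    refine hG.self_of_nhds.ext fun z => ?_
    rw [curvatureEnd_pair_symm hd hG, hc, hinv, ← curvatureEnd_pair_symm hd hG]
  unfold coordRicci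
  have h1 : (curvatureEnd G y (J y v) (J y w) : E →ₗ[ℝ] E) =
      (J y : E →ₗ[ℝ] E) * (curvatureEnd G y (J y v) w : E →ₗ[ℝ] E) := by
    ext u; simp [hc]
  have h2 : (curvatureEnd G y (J y v) w : E →ₗ[ℝ] E) * (J y : E →ₗ[ℝ] E) =
      (curvatureEnd G y v w : E →ₗ[ℝ] E) := by
    ext u; simp [hJJ]
  rw [h1, LinearMap.trace_mul_comm, h2]

end Curvature

/-! ### Conformal change of the metric -/

section Conformal

variable {E : Type*} [NormedAddCommGroup E] [NormedSpace ℝ E]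

/-- The logarithmic derivative `df / f`. -/
noncomputable def logDifferential (f : E → ℝ) (y : E) : E →L[ℝ] ℝ := (f y)⁻¹ • fderiv ℝ f y

/-- The tensor `∇a - a ⊗ a`, where `a = df / f` and `∇` is the Levi-Civita connection of `G`, in
coordinates. It equals `-f` times the Hessian of `1 / f` with respect to `G`. -/
noncomputable def conformalHessian (G : E → E →L[ℝ] E →L[ℝ] ℝ) (f : E → ℝ) (y v w : E) : ℝ :=
  fderiv ℝ (logDifferential f) y v w - logDifferential f y (christoffel G y v w)
    - logDifferential f y v * logDifferential f y w

variable {G : E → E →L[ℝ] E →L[ℝ] ℝ} {f : E → ℝ} {y : E}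

theorem IsInner.smul_sq {B : E →L[ℝ] E →L[ℝ] ℝ} (hB : IsInner B) {c : ℝ} (hc : c ≠ 0) :
    IsInner (c ^ 2 • B) where
  symm v w := by simp [hB.symm v w]
  pos v hv := by
    have := hB.pos v hv
    simp only [smul_apply, smul_eq_mul]
    positivity

theorem contDiffAt_logDifferential {m n : ℕ∞ω} (hf : ContDiffAt ℝ n f y) (hf0 : f y ≠ 0)
    (hmn : m + 1 ≤ n) : ContDiffAt ℝ m (logDifferential f) y :=
  ((hf.of_le (le_trans le_self_add hmn)).inv hf0).smul (hf.fderiv_right hmn)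

theorem fderiv_logDifferential_symm (hf : ContDiffAt ℝ 2 f y) (hf0 : f y ≠ 0) (v w : E) :
    fderiv ℝ (logDifferential f) y v w = fderiv ℝ (logDifferential f) y w v := by
  have ha : DifferentiableAt ℝ (logDifferential f) y :=
    (contDiffAt_logDifferential (m := 1) hf hf0 (by norm_num)).differentiableAt (by simp)
  -- `df / f` is the differential of `log |f|`, and `Real.log` is `log |·|` on nonzero reals.
  refine second_derivative_symmetric_of_eventually (𝕜 := ℝ) (f := fun x => Real.log (f x)) ?_
    ha.hasFDerivAt v w
  filter_upwards [hf.eventually (by simp), hf.continuousAt.eventually_ne hf0] with x hx hx0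
  exact ((hx.differentiableAt (by simp)).hasFDerivAt).log hx0

variable [FiniteDimensional ℝ E]

/-- The Levi-Civita connection of the metric `f² G`. -/
theorem christoffel_conformal (hG : ∀ᶠ x in nhds y, IsInner (G x)) (hd : DifferentiableAt ℝ G y)
    (hf : DifferentiableAt ℝ f y) (hf0 : f y ≠ 0) (v w : E) :
    christoffel (fun x => f x ^ 2 • G x) y v w = christoffel G y v w
      + logDifferential f y v • w + logDifferential f y w • v
      - G y v w • (G y).inverse (logDifferential f y) := by
  have hGy := hG.self_of_nhds
  have hs : ∀ᶠ x in nhds y, ∀ v w, G x v w = G x w v := hG.mono fun z hz => hz.symm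
  refine eq_christoffel (T := fun v w => christoffel G y v w
      + logDifferential f y v • w + logDifferential f y w • v
      - G y v w • (G y).inverse (logDifferential f y)) (hGy.smul_sq hf0) ?_ ?_ v w
  · intro v w
    simp only [christoffel_symm hGy hd hs v w, hGy.symm v w]
    abel
  · intro u v w
    have h1 : fderiv ℝ (fun x => f x ^ 2 • G x) y u v w =
        f y ^ 2 * fderiv ℝ G y u v w + 2 * f y * fderiv ℝ f y u * G y v w := by
      have h2 : HasFDerivAt (fun x => f x ^ 2 • G x) _ y :=
        (hf.hasFDerivAt.pow 2).smul hd.hasFDerivAt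
      rw [h2.fderiv]
      simp
    have hsh : ∀ z, G y ((G y).inverse (logDifferential f y)) z = logDifferential f y z := by
      intro z; rw [hGy.apply_inverse]
    have hsh' : ∀ z, G y z ((G y).inverse (logDifferential f y)) = logDifferential f y z := by
      intro z; rw [hGy.symm, hsh]
    have ha : fderiv ℝ f y u = f y * logDifferential f y u := by
      simp [logDifferential, hf0]
    rw [h1, fderiv_eq_christoffel hGy hd hs, ha]
    simp only [smul_apply, smul_eq_mul, map_sub, map_add, sub_apply, add_apply,
      map_smul, hsh, hsh', hGy.symm v u]
    ring

/-- The Ricci tensors of `f² G` and `G` differ by `-(n - 2)` times the conformal Hessian, up to a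
multiple of the metric, whose coefficient plays no role. -/
theorem coordRicci_conformal (hG : ∀ᶠ x in nhds y, IsInner (G x)) (hd : ContDiffAt ℝ 2 G y)
    (hf : ContDiffAt ℝ 2 f y) (hf0 : f y ≠ 0) : ∃ t : ℝ, ∀ v w,
      coordRicci (fun x => f x ^ 2 • G x) y v w = coordRicci G y v w
        - (Module.finrank ℝ E - 2) * conformalHessian G f y v w - t * G y v w := by
  have hGy := hG.self_of_nhds
  have hdG : DifferentiableAt ℝ G y := hd.differentiableAt (by simp)
  have hs : ∀ᶠ x in nhds y, ∀ v w, G x v w = G x w v := hG.mono fun z hz => hz.symm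
  have hΓ : DifferentiableAt ℝ (christoffel G) y :=
    (contDiffAt_christoffel (m := 1) hGy hd (by norm_num)).differentiableAt (by simp)
  have hda1 := contDiffAt_logDifferential (m := 1) hf hf0 (by norm_num)
  have hda : DifferentiableAt ℝ (logDifferential f) y := hda1.differentiableAt (by simp)
  have hds : DifferentiableAt ℝ (fun x => (G x).inverse (logDifferential f x)) y :=
    ((contDiffAt_clm_inverse (hd.of_le (m := 1) (by norm_num)) hGy.isInvertible).clm_apply
      hda1).differentiableAt (by simp)
  have hDa := fderiv_logDifferential_symm hf hf0
  set g : E → E →L[ℝ] E →L[ℝ] ℝ := fun x => f x ^ 2 • G x with hg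
  have hg1 : ContDiffAt ℝ 2 g y := (hf.pow 2).smul hd
  have hfx : ∀ᶠ x in nhds y, f x ≠ 0 := hf.continuousAt.eventually_ne hf0
  have hgi : ∀ᶠ x in nhds y, IsInner (g x) := by
    filter_upwards [hG, hfx] with x hx hx0 using hx.smul_sq hx0
  have hΓg : DifferentiableAt ℝ (christoffel g) y :=
    (contDiffAt_christoffel (m := 1) hgi.self_of_nhds hg1 (by norm_num)).differentiableAt (by simp)
  set a := logDifferential f with ha
  set s : E → E := fun x => (G x).inverse (a x) with hs_def
  set Ds := fderiv ℝ s y with hDs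
  have hev : ∀ᶠ x in nhds y, ∀ v w, christoffel g x v w = christoffel G x v w
      + a x v • w + a x w • v - G x v w • s x := by
    filter_upwards [hG.eventually_nhds, hd.eventually (by simp), hf.eventually (by simp), hfx]
      with x h1 h2 h3 h4
    exact christoffel_conformal h1 (h2.differentiableAt (by simp)) (h3.differentiableAt (by simp)) h4
  have hDΓ : ∀ u v w, fderiv ℝ (christoffel g) y u v w = fderiv ℝ (christoffel G) y u v w
      + fderiv ℝ a y u v • w + fderiv ℝ a y u w • v
      - (fderiv ℝ G y u v w • s y + G y v w • Ds u) := by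
    intro u v w
    have cv := hasFDerivAt_const (𝕜 := ℝ) v y
    have cw := hasFDerivAt_const (𝕜 := ℝ) w y
    have h1 : HasFDerivAt (fun x => christoffel g x v w) _ y :=
      (hΓg.hasFDerivAt.clm_apply cv).clm_apply cw
    have h2 : HasFDerivAt (fun x => christoffel G x v w + a x v • w + a x w • v - G x v w • s x)
        _ y :=
      ((((hΓ.hasFDerivAt.clm_apply cv).clm_apply cw).add
        ((hda.hasFDerivAt.clm_apply cv).smul_const w)).add
        ((hda.hasFDerivAt.clm_apply cw).smul_const v)).sub
        (((hdG.hasFDerivAt.clm_apply cv).clm_apply cw).smul hds.hasFDerivAt)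
    have h3 := h1.unique (h2.congr_of_eventuallyEq (hev.mono fun x hx => hx v w))
    have h4 := congrArg (fun L : E →L[ℝ] E => L u) h3
    simp at h4
    rw [h4]; abel
  have hΓgy := hev.self_of_nhds
  have hsh : ∀ z, G y (s y) z = a y z := fun z => by rw [hs_def, hGy.apply_inverse]
  have hsh' : ∀ z, G y z (s y) = a y z := fun z => by rw [hGy.symm, hsh]
  have hDG := fderiv_eq_christoffel hGy hdG hs
  -- `B = ∇ a♯` is metrically dual to `∇ a`.
  let B : E →L[ℝ] E := Ds + (christoffel G y).flip (s y)
  have hB : ∀ v w, G y (B v) w = fderiv ℝ a y v w - a y (christoffel G y v w) := by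
    intro v w
    have h1 : HasFDerivAt (fun x => G x (s x) w) _ y :=
      (hdG.hasFDerivAt.clm_apply hds.hasFDerivAt).clm_apply (hasFDerivAt_const w y)
    have h2 : HasFDerivAt (fun x => a x w) _ y :=
      hda.hasFDerivAt.clm_apply (hasFDerivAt_const w y)
    have h3 := h1.unique (h2.congr_of_eventuallyEq (hG.mono fun x hx => by
      simp only [hs_def, hx.apply_inverse]))
    have h4 := congrArg (fun L : E →L[ℝ] ℝ => L v) h3
    simp at h4
    rw [← hDs, hDG, hsh] at h4
    simp only [B, add_apply, ContinuousLinearMap.flip_apply, map_add]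
    linarith
  -- The change of the curvature endomorphism, as a sum of terms whose traces are evident.
  have hR : ∀ v w, (curvatureEnd g y v w : E →ₗ[ℝ] E) = (curvatureEnd G y v w : E →ₗ[ℝ] E)
      + ((G y).flip w ∘L B : E →ₗ[ℝ] ℝ).smulRight v - (G y (B v) w - a y v * a y w) • LinearMap.id
      - G y v w • (B : E →ₗ[ℝ] E) + ((G y).flip w : E →ₗ[ℝ] ℝ).smulRight (B v)
      - a y w • (a y : E →ₗ[ℝ] ℝ).smulRight v
      - (a y (s y) * G y v w) • LinearMap.id
      + a y (s y) • ((G y).flip w : E →ₗ[ℝ] ℝ).smulRight v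
      - a y v • ((G y).flip w : E →ₗ[ℝ] ℝ).smulRight (s y)
      + G y v w • (a y : E →ₗ[ℝ] ℝ).smulRight (s y) := by
    intro v w
    ext u
    have hΓs := christoffel_symm hGy hdG hs
    simp only [ContinuousLinearMap.coe_coe, curvatureEnd_apply, LinearMap.add_apply,
      LinearMap.sub_apply, LinearMap.smul_apply, LinearMap.smulRight_apply, LinearMap.id_apply,
      ContinuousLinearMap.comp_apply, ContinuousLinearMap.flip_apply, hB]
    simp only [hDΓ, hΓgy, hDG, B, add_apply, ContinuousLinearMap.flip_apply, map_add, map_sub,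
      map_smul, hsh', smul_eq_mul]
    rw [hDa v u, hΓs v u, hGy.symm v u, hGy.symm v (christoffel G y u w),
      hGy.symm u (christoffel G y v w)]
    module
  refine ⟨LinearMap.trace ℝ E (B : E →ₗ[ℝ] E) + (Module.finrank ℝ E - 2) * a y (s y),
    fun v w => ?_⟩
  unfold coordRicci conformalHessian
  rw [hR]
  simp only [map_add, map_sub, map_smul, LinearMap.trace_smulRight, LinearMap.trace_id,
    smul_eq_mul, ContinuousLinearMap.coe_coe, ContinuousLinearMap.comp_apply,
    ContinuousLinearMap.flip_apply, hB, hsh]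
  ring

/-- If the Ricci tensors of `G` and `f² G` are both invariant under a linear isometry of `G y`, then
so is the conformal Hessian. -/
theorem conformalHessian_invariant (hn : 2 < Module.finrank ℝ E)
    (hG : ∀ᶠ x in nhds y, IsInner (G x)) (hd : ContDiffAt ℝ 2 G y)
    (hf : ContDiffAt ℝ 2 f y) (hf0 : f y ≠ 0) {J : E →L[ℝ] E}
    (hinv : ∀ v w, G y (J v) (J w) = G y v w)
    (hR : ∀ v w, coordRicci G y (J v) (J w) = coordRicci G y v w)
    (hRg : ∀ v w, coordRicci (fun x => f x ^ 2 • G x) y (J v) (J w) =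
      coordRicci (fun x => f x ^ 2 • G x) y v w) (v w : E) :
    conformalHessian G f y (J v) (J w) = conformalHessian G f y v w := by
  obtain ⟨t, ht⟩ := coordRicci_conformal hG hd hf hf0
  have h := hRg v w
  rw [ht, ht, hR, hinv] at h
  have hn' : (Module.finrank ℝ E : ℝ) - 2 ≠ 0 := by
    have : (2 : ℝ) < Module.finrank ℝ E := by exact_mod_cast hn
    linarith
  exact mul_left_cancel₀ hn' (by linarith)

/-- The `1`-form `κ(v) = a(J v) / f`, `a = df / f`. It is dual, for the metric `G`, to `J` applied
to the gradient of `1 / f`. -/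
noncomputable def killingForm (f : E → ℝ) (J : E → E →L[ℝ] E) (y : E) : E →L[ℝ] ℝ :=
  (f y)⁻¹ • (logDifferential f y).comp (J y)

/-- The Killing equation, on the diagonal: with the formula for the connection of `f² G`, the left
side minus the right side is `conformalHessian G f y v (J v) / f`, which vanishes because the
conformal Hessian is symmetric and `J`-invariant. -/
theorem killingForm_killing_self (hG : ∀ᶠ x in nhds y, IsInner (G x)) (hd : ContDiffAt ℝ 2 G y)
    (hf : ContDiffAt ℝ 2 f y) (hf0 : f y ≠ 0) {J : E → E →L[ℝ] E} (hJ : DifferentiableAt ℝ J y)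
    (hJ2 : ∀ v, J y (J y v) = - v) (hinv : ∀ v w, G y (J y v) (J y w) = G y v w)
    (hpar : ∀ v w, fderiv ℝ J y v w = J y (christoffel (fun x => f x ^ 2 • G x) y v w)
      - christoffel (fun x => f x ^ 2 • G x) y v (J y w))
    (hc : ∀ v w, conformalHessian G f y (J y v) (J y w) = conformalHessian G f y v w) (v : E) :
    fderiv ℝ (killingForm f J) y v v = killingForm f J y (christoffel G y v v) := by
  have hGy := hG.self_of_nhds
  have hdG : DifferentiableAt ℝ G y := hd.differentiableAt (by simp)
  have hfd : DifferentiableAt ℝ f y := hf.differentiableAt (by simp)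
  have hs : ∀ᶠ x in nhds y, ∀ v w, G x v w = G x w v := hG.mono fun z hz => hz.symm
  have hda : DifferentiableAt ℝ (logDifferential f) y :=
    (contDiffAt_logDifferential (m := 1) hf hf0 (by norm_num)).differentiableAt (by simp)
  have hΓ := christoffel_conformal hG hdG hfd hf0
  have hder : fderiv ℝ (killingForm f J) y v v =
      (f y)⁻¹ * (- logDifferential f y v * logDifferential f y (J y v)
        + fderiv ℝ (logDifferential f) y v (J y v) + logDifferential f y (fderiv ℝ J y v v)) := by
    have h1 : HasFDerivAt (killingForm f J) _ y :=
      ((hasDerivAt_inv hf0).comp_hasFDerivAt y hfd.hasFDerivAt).smul (hda.hasFDerivAt.clm_comp hJ.hasFDerivAt)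
    rw [h1.fderiv]
    simp [logDifferential]
    ring
  have hskew : ∀ u, G y u (J y u) = 0 := by
    intro u
    have h1 := hinv u (J y u)
    rw [hJ2, map_neg, hGy.symm] at h1
    linarith
  have hsh : ∀ z, logDifferential f y z = G y ((G y).inverse (logDifferential f y)) z := by
    intro z; rw [hGy.apply_inverse]
  -- `J` applied to the gradient is orthogonal to the gradient.
  have h0 : logDifferential f y (J y ((G y).inverse (logDifferential f y))) = 0 := by
    rw [hsh, hskew]
  have hcs : conformalHessian G f y v (J y v) = 0 := by
    have h1 := hc v (J y v)
    have h2 : conformalHessian G f y (J y v) v = conformalHessian G f y v (J y v) := by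
      simp only [conformalHessian]
      rw [fderiv_logDifferential_symm hf hf0, christoffel_symm hGy hdG hs]; ring
    have h3 : conformalHessian G f y (J y v) (-v) = - conformalHessian G f y (J y v) v := by
      simp only [conformalHessian, map_neg]; ring
    rw [hJ2, h3, h2] at h1
    linarith
  rw [hder, hpar, hΓ, hΓ, hskew]
  simp only [conformalHessian] at hcs
  simp only [killingForm, smul_apply, ContinuousLinearMap.comp_apply,
    smul_eq_mul, map_sub, map_add, map_smul, h0, zero_smul, map_zero]
  congr 1
  linear_combination hcs

end Conformal

/-! ### Regularity of forms with a symmetrised derivative of class `C¹` -/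

section Regularity

variable {E : Type*} [NormedAddCommGroup E] [NormedSpace ℝ E]

/-- A quantitative rigidity estimate for `1`-forms: if the symmetrised derivative `e` of `k` is
`η`-Lipschitz, and `k` and its derivative `A` vanish at `0`, then `A` is `O(η ‖x‖)`.

The function `x ↦ k (x + v) v - k x v` is the integral of `e(v, v)` along a segment, so its
derivative `w ↦ A (x + v) w v - A x w v` has norm at most `η ‖v‖²`. This controls `A` on pairs containing
the direction of displacement, hence `k` on radial segments, and then `A` itself. -/
theorem norm_fderiv_le_of_symmetrised_lipschitz {k : E → E →L[ℝ] ℝ} {A : E → E →L[ℝ] E →L[ℝ] ℝ}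
    {e : E → E →L[ℝ] E →L[ℝ] ℝ} {r η : ℝ} (hη : 0 ≤ η)
    (hk : ∀ x ∈ Metric.ball (0 : E) r, HasFDerivAt k (A x) x)
    (he : ∀ x ∈ Metric.ball (0 : E) r, ∀ v w, A x v w + A x w v = 2 * e x v w)
    (hlip : ∀ x ∈ Metric.ball (0 : E) r, ∀ y ∈ Metric.ball (0 : E) r, ‖e x - e y‖ ≤ η * ‖x - y‖)
    (hk0 : k 0 = 0) (hA0 : A 0 = 0) {x : E} (hx : 2 * ‖x‖ < r) : ‖A x‖ ≤ 18 * η * ‖x‖ := by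
  have hr : 0 < r := lt_of_le_of_lt (by positivity) hx
  have h0 : (0 : E) ∈ Metric.ball (0 : E) r := Metric.mem_ball_self hr
  have hconv := convex_ball (0 : E) r
  have hev : ∀ x ∈ Metric.ball (0 : E) r, ∀ y ∈ Metric.ball (0 : E) r, ∀ v w,
      |e x v w - e y v w| ≤ η * ‖x - y‖ * ‖v‖ * ‖w‖ := by
    intro x hx y hy v w
    have := (e x - e y).le_opNorm₂ v w
    simp only [sub_apply, Real.norm_eq_abs] at this
    refine this.trans ?_
    gcongr
    exact hlip x hx y hy
  have hline : ∀ (y u : E) (t : ℝ), HasDerivAt (fun s : ℝ => y + s • u) u t := by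
    intro y u t
    simpa using ((hasDerivAt_id t).smul_const u).const_add y
  have hkline : ∀ (y u z : E) (t : ℝ), y + t • u ∈ Metric.ball (0 : E) r →
      HasDerivAt (fun s : ℝ => k (y + s • u) z) (A (y + t • u) u z) t := by
    intro y u z t hy
    have h1 := (hk _ hy).comp_hasDerivAt t (hline y u t)
    simpa using h1.clm_apply (hasDerivAt_const t z)
  have hseg : ∀ y u : E, y ∈ Metric.ball (0 : E) r → y + u ∈ Metric.ball (0 : E) r →
      ∀ t ∈ Set.Icc (0 : ℝ) 1, y + t • u ∈ Metric.ball (0 : E) r := by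
    intro y u hy hyu t ht
    simpa using hconv.add_smul_mem hy hyu ht
  have step1 : ∀ y v w, y ∈ Metric.ball (0 : E) r → y + v ∈ Metric.ball (0 : E) r →
      |A (y + v) w v - A y w v| ≤ η * ‖v‖ ^ 2 * ‖w‖ := by
    intro y v w hy hyv
    have hG : HasFDerivAt (fun z => k (z + v) v - k z v)
        (((A (y + v)).flip v) - (A y).flip v) y := by
      have h1 : HasFDerivAt (fun z => k (z + v)) (A (y + v)) y := by
        exact (hasFDerivAt_comp_add_right v).2 (hk _ hyv)
      have h2 := (h1.clm_apply (hasFDerivAt_const v y)).sub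
        ((hk _ hy).clm_apply (hasFDerivAt_const v y))
      refine h2.congr_fderiv ?_
      ext z; simp
    have hle : ‖((A (y + v)).flip v) - (A y).flip v‖ ≤ η * ‖v‖ ^ 2 := by
      refine hG.le_of_lip' (by positivity) ?_
      have e1 : ∀ᶠ z in nhds y, z ∈ Metric.ball (0 : E) r := Metric.isOpen_ball.mem_nhds hy
      have e2 : ∀ᶠ z in nhds y, z + v ∈ Metric.ball (0 : E) r :=
        (continuous_id.add continuous_const).continuousAt.preimage_mem_nhds
          (Metric.isOpen_ball.mem_nhds hyv)
      filter_upwards [e1, e2] with z hz hzv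
      have := norm_image_sub_le_of_norm_deriv_le_segment_01'
        (f := fun t : ℝ => k (z + t • v) v - k (y + t • v) v)
        (f' := fun t => A (z + t • v) v v - A (y + t • v) v v) (C := η * ‖v‖ ^ 2 * ‖z - y‖) ?_ ?_
      · have hrw : k (z + v) v - k z v - (k (y + v) v - k y v) =
            (k (z + (1 : ℝ) • v) v - k (y + (1 : ℝ) • v) v)
              - (k (z + (0 : ℝ) • v) v - k (y + (0 : ℝ) • v) v) := by
          simp only [one_smul, zero_smul, add_zero]; ring
        rw [hrw]; exact this
      · intro t ht
        exact ((hkline z v v t (hseg z v hz hzv t ht)).sub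
          (hkline y v v t (hseg y v hy hyv t ht))).hasDerivWithinAt
      · intro t ht
        have ht' := Set.Ico_subset_Icc_self ht
        have m1 := hseg z v hz hzv t ht'
        have m2 := hseg y v hy hyv t ht'
        have b := hev _ m1 _ m2 v v
        have c1 := he _ m1 v v
        have c2 := he _ m2 v v
        have : A (z + t • v) v v - A (y + t • v) v v = e (z + t • v) v v - e (y + t • v) v v := by
          linarith
        rw [Real.norm_eq_abs, this]
        refine b.trans (le_of_eq ?_)
        rw [add_sub_add_right_eq_sub]; ring
    have := (((A (y + v)).flip v) - (A y).flip v).le_of_opNorm_le hle w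
    simpa using this
  -- The same estimate at the intermediate point of a segment, with the parameter divided out.
  have step1' : ∀ y v w, y ∈ Metric.ball (0 : E) r → y + v ∈ Metric.ball (0 : E) r →
      ∀ t ∈ Set.Icc (0 : ℝ) 1, |A (y + t • v) w v - A y w v| ≤ η * ‖v‖ ^ 2 * ‖w‖ := by
    intro y v w hy hyv t ht
    rcases ht.1.eq_or_lt with rfl | htp
    · simp; positivity
    have h1 := step1 y (t • v) w hy (hseg y v hy hyv t ht)
    simp only [map_smul, smul_eq_mul, norm_smul, Real.norm_eq_abs, abs_of_pos htp] at h1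
    rw [← mul_sub, abs_mul, abs_of_pos htp] at h1
    have h2 : |A (y + t • v) w v - A y w v| ≤ t * (η * ‖v‖ ^ 2 * ‖w‖) := by
      refine le_of_mul_le_mul_left (h1.trans (le_of_eq ?_)) htp
      ring
    refine h2.trans (mul_le_of_le_one_left (by positivity) ht.2)
  have step3 : ∀ y v w, y ∈ Metric.ball (0 : E) r → y + w ∈ Metric.ball (0 : E) r →
      |k (y + w) v - k y v - A y w v| ≤ 3 * η * ‖w‖ ^ 2 * ‖v‖ := by
    intro y v w hy hyw
    have := norm_image_sub_le_of_norm_deriv_le_segment_01'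
      (f := fun t : ℝ => k (y + t • w) v - t * A y w v)
      (f' := fun t => A (y + t • w) w v - A y w v) (C := 3 * η * ‖w‖ ^ 2 * ‖v‖) ?_ ?_
    · have hrw : k (y + w) v - k y v - A y w v = (k (y + (1 : ℝ) • w) v - 1 * A y w v)
          - (k (y + (0 : ℝ) • w) v - 0 * A y w v) := by
        simp only [one_smul, zero_smul, add_zero]; ring
      rw [hrw]; exact this
    · intro t ht
      have h1 := (hkline y w v t (hseg y w hy hyw t ht)).sub
        ((hasDerivAt_id t).mul_const (A y w v))
      rw [one_mul] at h1
      exact h1.hasDerivWithinAt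
    · intro t ht
      have ht' := Set.Ico_subset_Icc_self ht
      have m1 := hseg y w hy hyw t ht'
      have b := hev _ m1 _ hy w v
      have c1 := he _ m1 w v
      have c2 := he _ hy w v
      have c3 := step1' y w v hy hyw t ht'
      have hn : ‖y + t • w - y‖ ≤ ‖w‖ := by
        rw [add_sub_cancel_left, norm_smul, Real.norm_eq_abs, abs_of_nonneg ht.1]
        exact mul_le_of_le_one_left (norm_nonneg _) ht.2.le
      have b' : |e (y + t • w) w v - e y w v| ≤ η * ‖w‖ ^ 2 * ‖v‖ := by
        refine b.trans ?_
        have : η * ‖y + t • w - y‖ * ‖w‖ * ‖v‖ ≤ η * ‖w‖ * ‖w‖ * ‖v‖ := by gcongr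
        exact this.trans (le_of_eq (by ring))
      rw [Real.norm_eq_abs]
      rw [abs_le] at *
      constructor <;> linarith
  have step4 : ∀ y v, y ∈ Metric.ball (0 : E) r → |k y v| ≤ 3 * η * ‖y‖ ^ 2 * ‖v‖ := by
    intro y v hy
    simpa [hk0, hA0] using step3 0 v y h0 (by simpa using hy)
  rcases eq_or_ne x 0 with rfl | hx0
  · simp [hA0]
  have hxp : 0 < ‖x‖ := norm_pos_iff.2 hx0
  have hxb : x ∈ Metric.ball (0 : E) r := by rw [mem_ball_zero_iff]; linarith
  have step5 : ∀ w v, ‖w‖ = ‖x‖ → |A x w v| ≤ 18 * η * ‖x‖ * ‖w‖ * ‖v‖ := by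
    intro w v hw
    have hn : ‖x + w‖ ≤ 2 * ‖x‖ := (norm_add_le _ _).trans (by rw [hw]; linarith)
    have hxw : x + w ∈ Metric.ball (0 : E) r := by rw [mem_ball_zero_iff]; linarith
    have a1 := step3 x v w hxb hxw
    have a2 := step4 x v hxb
    have a3 := step4 (x + w) v hxw
    have a4 : 3 * η * ‖x + w‖ ^ 2 * ‖v‖ ≤ 3 * η * (2 * ‖x‖) ^ 2 * ‖v‖ := by gcongr
    rw [hw] at *
    rw [abs_le] at *
    constructor <;> nlinarith
  refine ContinuousLinearMap.opNorm_le_bound₂ _ (by positivity) fun w v => ?_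
  rcases eq_or_ne w 0 with rfl | hw0
  · simp
  have hwp : 0 < ‖w‖ := norm_pos_iff.2 hw0
  have hc : 0 < ‖x‖ / ‖w‖ := by positivity
  have := step5 ((‖x‖ / ‖w‖) • w) v (by
    rw [norm_smul, Real.norm_eq_abs, abs_of_pos hc]; field_simp)
  simp only [map_smul, smul_apply, smul_eq_mul, norm_smul, abs_mul, Real.norm_eq_abs,
    abs_of_pos hc] at this
  rw [Real.norm_eq_abs]
  refine le_of_mul_le_mul_left (this.trans (le_of_eq ?_)) hc
  ring

/-- The first jet of a `1`-form whose symmetrised derivative `e` is strictly differentiable is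
differentiable, and its derivative is given by the Saint-Venant formula
`∂_v ∂_w κ(z) = (∂_v e)(w, z) + (∂_w e)(v, z) - (∂_z e)(v, w)`. -/
theorem hasFDerivAt_fderiv_of_symmetrised {κ : E → E →L[ℝ] ℝ} {e : E → E →L[ℝ] E →L[ℝ] ℝ}
    {De : E →L[ℝ] E →L[ℝ] E →L[ℝ] ℝ} {p : E} (hκ : ∀ᶠ x in nhds p, DifferentiableAt ℝ κ x)
    (he : ∀ᶠ x in nhds p, ∀ v w, fderiv ℝ κ x v w + fderiv ℝ κ x w v = 2 * e x v w)
    (hDe : HasStrictFDerivAt e De p) {C : E →L[ℝ] E →L[ℝ] E →L[ℝ] ℝ}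
    (hC : ∀ v w z, C v w z = De v w z + De w v z - De z v w) :
    HasFDerivAt (fderiv ℝ κ) C p := by
  have hDs : ∀ u v w, De u v w = De u w v := by
    intro u v w
    have h1 := (hDe.hasFDerivAt.clm_apply (hasFDerivAt_const v p)).clm_apply (hasFDerivAt_const w p)
    have h2 := (hDe.hasFDerivAt.clm_apply (hasFDerivAt_const w p)).clm_apply (hasFDerivAt_const v p)
    have hev : (fun x => e x v w) =ᶠ[nhds p] fun x => e x w v := by
      filter_upwards [he] with x hx
      linarith [hx v w, hx w v]
    have h3 := h1.unique (h2.congr_of_eventuallyEq hev)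
    simpa using congrArg (fun L : E →L[ℝ] ℝ => L u) h3
  have hCs : ∀ v w, C v w = C w v := by
    intro v w; ext z; rw [hC, hC, hDs z v w]; ring
  -- Subtracting the quadratic polynomial with the expected second derivative `C` reduces the claim
  -- to the case where the symmetrised derivative has Lipschitz constant `η` on a small ball.
  rw [hasFDerivAt_iff_isLittleO_nhds_zero, Asymptotics.isLittleO_iff]
  intro c hc
  have hη : 0 < c / 18 := by positivity
  have hlip := hDe.isLittleO.def hη
  rw [nhds_prod_eq, Filter.Eventually, Filter.mem_prod_same_iff] at hlip
  obtain ⟨s, hs, hs'⟩ := hlip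
  obtain ⟨r, hr, hball⟩ := Metric.mem_nhds_iff.1 (Filter.inter_mem hs (Filter.inter_mem hκ he))
  have hmem : ∀ x ∈ Metric.ball (0 : E) r, p + x ∈ Metric.ball p r := by
    intro x hx; simpa using hx
  filter_upwards [Metric.ball_mem_nhds (0 : E) (half_pos hr)] with x hx
  rw [mem_ball_zero_iff] at hx
  have := norm_fderiv_le_of_symmetrised_lipschitz (r := r) (η := c / 18) hη.le
    (k := fun x => κ (p + x) - κ p - fderiv ℝ κ p x - (1 / 2 : ℝ) • C x x)
    (A := fun x => fderiv ℝ κ (p + x) - fderiv ℝ κ p - C x)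
    (e := fun x => e (p + x) - e p - De x) ?_ ?_ ?_ (by simp) (by simp) (x := x) (by linarith)
  · refine this.trans (le_of_eq ?_)
    ring
  · intro x hx
    have hd : DifferentiableAt ℝ κ (p + x) := (hball (hmem x hx)).2.1
    have h1 : HasFDerivAt (fun z => κ (p + z)) (fderiv ℝ κ (p + x)) x := by
      exact (hasFDerivAt_comp_add_left p).2 hd.hasFDerivAt
    have h2 := ((h1.sub_const (κ p)).sub (fderiv ℝ κ p).hasFDerivAt).sub
      ((C.hasFDerivAt.clm_apply (hasFDerivAt_id x)).const_smul (1 / 2 : ℝ))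
    refine h2.congr_fderiv ?_
    ext w z
    simp only [sub_apply, add_apply, smul_apply, smul_eq_mul, ContinuousLinearMap.comp_apply,
      ContinuousLinearMap.flip_apply, id_eq, ContinuousLinearMap.id_apply, hCs w x]
    ring
  · intro x hx v w
    have h1 := (hball (hmem x hx)).2.2 v w
    have h2 := (hball (Metric.mem_ball_self hr)).2.2 v w
    simp only [sub_apply, hC]
    have h3 := hDs x v w
    have h4 := hDs w x v
    have h5 := hDs v x w
    have h6 := hDs w v x
    have h7 := hDs v w x
    linarith
  · intro x hx y hy
    have hxy : (p + x, p + y) ∈ s ×ˢ s := ⟨(hball (hmem x hx)).1, (hball (hmem y hy)).1⟩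
    have h1 := hs' hxy
    simp only [Set.mem_ofPred_eq, add_sub_add_left_eq_sub] at h1
    have h2 : e (p + x) - e p - De x - (e (p + y) - e p - De y) =
        e (p + x) - e (p + y) - De (x - y) := by
      rw [map_sub]; abel
    rw [h2]
    exact h1

end Regularity

/-! ### Prolongation of the Killing equation -/

section Prolongation

variable {E : Type*} [NormedAddCommGroup E] [NormedSpace ℝ E]

/-- Prolongation of the Killing equation: the first jet of a `C¹` solution is differentiable, and
its derivative is bounded by the solution and its first derivative. -/
theorem exists_hasFDerivAt_fderiv_of_killing {κ : E → E →L[ℝ] ℝ} {Γ : E → E →L[ℝ] E →L[ℝ] E}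
    {p : E} {c : ℝ} (hκ : ContDiffAt ℝ 1 κ p) (hΓ : ContDiffAt ℝ 1 Γ p)
    (hkill : ∀ᶠ x in nhds p, ∀ v w,
      fderiv ℝ κ x v w + fderiv ℝ κ x w v = 2 * κ x (Γ x v w))
    (hc : ‖Γ p‖ ≤ c) (hc' : ‖fderiv ℝ Γ p‖ ≤ c) :
    ∃ C : E →L[ℝ] E →L[ℝ] E →L[ℝ] ℝ, HasFDerivAt (fderiv ℝ κ) C p ∧ ‖C‖ ≤ 3 * c * (‖κ p‖ + ‖fderiv ℝ κ p‖) := by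
  have hc0 : 0 ≤ c := (norm_nonneg _).trans hc
  let e : E → E →L[ℝ] E →L[ℝ] ℝ := fun x =>
    (ContinuousLinearMap.compL ℝ E E ℝ (κ x)).comp (Γ x)
  have hκd := hκ.differentiableAt (by simp)
  have hΓd := hΓ.differentiableAt (by simp)
  have he : ContDiffAt ℝ 1 e p :=
    ((ContinuousLinearMap.compL ℝ E E ℝ).contDiff.contDiffAt.comp p hκ).clm_comp hΓ
  have hDe := he.hasStrictFDerivAt (by simp)
  set De := fderiv ℝ e p with hDe_def
  have hval : ∀ v w z, De v w z = fderiv ℝ κ p v (Γ p w z) + κ p (fderiv ℝ Γ p v w z) := by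
    intro v w z
    have h1 := (hDe.hasFDerivAt.clm_apply (hasFDerivAt_const w p)).clm_apply (hasFDerivAt_const z p)
    have h2 : HasFDerivAt (fun x => κ x (Γ x w z)) _ p :=
      hκd.hasFDerivAt.clm_apply ((hΓd.hasFDerivAt.clm_apply (hasFDerivAt_const w p)).clm_apply
        (hasFDerivAt_const z p))
    have h3 := congrArg (fun L : E →L[ℝ] ℝ => L v) (h1.unique h2)
    simp at h3
    rw [h3]; ring
  have hnorm : ‖De‖ ≤ c * (‖κ p‖ + ‖fderiv ℝ κ p‖) := by
    refine ContinuousLinearMap.opNorm_le_bound _ (by positivity) fun v => ?_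
    refine ContinuousLinearMap.opNorm_le_bound₂ _ (by positivity) fun w z => ?_
    rw [hval]
    have a1 : ‖fderiv ℝ κ p v (Γ p w z)‖ ≤ ‖fderiv ℝ κ p‖ * ‖v‖ * (c * ‖w‖ * ‖z‖) := by
      refine ((fderiv ℝ κ p).le_opNorm₂ _ _).trans ?_
      gcongr
      exact ((Γ p).le_opNorm₂ _ _).trans (by gcongr)
    have a2 : ‖κ p (fderiv ℝ Γ p v w z)‖ ≤ ‖κ p‖ * (c * ‖v‖ * ‖w‖ * ‖z‖) := by
      refine ((κ p).le_opNorm _).trans ?_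
      gcongr
      refine ((fderiv ℝ Γ p v).le_opNorm₂ _ _).trans ?_
      gcongr
      exact ((fderiv ℝ Γ p).le_opNorm _).trans (by gcongr)
    refine (norm_add_le _ _).trans ((add_le_add a1 a2).trans (le_of_eq ?_))
    ring
  let F := ContinuousLinearMap.flipₗᵢ ℝ E E ℝ
  let C : E →L[ℝ] E →L[ℝ] E →L[ℝ] ℝ :=
    De + De.flip - F.toContinuousLinearEquiv.toContinuousLinearMap.comp De.flip
  have hC : ∀ v w z, C v w z = De v w z + De w v z - De z v w := by
    intro v w z; simp [C, F]
  refine ⟨C, hasFDerivAt_fderiv_of_symmetrised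
    ((hκ.eventually (by simp)).mono fun x hx => hx.differentiableAt (by simp)) hkill hDe hC, ?_⟩
  have hC3 : ‖C‖ ≤ 3 * ‖De‖ := by
    have b : ∀ v w z, ‖De v w z‖ ≤ ‖De‖ * ‖v‖ * ‖w‖ * ‖z‖ := fun v w z =>
      ((De v).le_opNorm₂ w z).trans (by gcongr; exact De.le_opNorm v)
    refine ContinuousLinearMap.opNorm_le_bound _ (by positivity) fun v => ?_
    refine ContinuousLinearMap.opNorm_le_bound₂ _ (by positivity) fun w z => ?_
    rw [hC]
    refine (norm_sub_le _ _).trans ((add_le_add_left (norm_add_le _ _) _).trans ?_)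
    refine (add_le_add (add_le_add (b v w z) (b w v z)) (b z v w)).trans (le_of_eq ?_)
    ring
  linarith

/-- A solution of the Killing equation is bounded at the end of a segment by its first jet at the
other end, with a constant that depends only on the connection and the length of the segment. -/
theorem norm_le_of_killing_segment {κ : E → E →L[ℝ] ℝ} {Γ : E → E →L[ℝ] E →L[ℝ] E}
    {q x : E} {c : ℝ} (hκ : ∀ z ∈ segment ℝ q x, ContDiffAt ℝ 1 κ z)
    (hΓ : ∀ z ∈ segment ℝ q x, ContDiffAt ℝ 1 Γ z)
    (hkill : ∀ z ∈ segment ℝ q x, ∀ᶠ y in nhds z, ∀ v w,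
      fderiv ℝ κ y v w + fderiv ℝ κ y w v = 2 * κ y (Γ y v w))
    (hc : ∀ z ∈ segment ℝ q x, ‖Γ z‖ ≤ c) (hc' : ∀ z ∈ segment ℝ q x, ‖fderiv ℝ Γ z‖ ≤ c) :
    ∀ z ∈ segment ℝ q x,
      ‖κ z‖ ≤ max ‖κ q‖ ‖fderiv ℝ κ q‖ * Real.exp ((6 * c + 1) * ‖x - q‖) := by
  have hc0 : 0 ≤ c := (norm_nonneg _).trans (hc q (left_mem_segment ℝ q x))
  have hmem : ∀ t ∈ Set.Icc (0 : ℝ) 1, q + t • (x - q) ∈ segment ℝ q x := by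
    intro t ht
    rw [segment_eq_image']
    exact ⟨t, ht, rfl⟩
  choose! C hC hCb using fun z (hz : z ∈ segment ℝ q x) =>
    exists_hasFDerivAt_fderiv_of_killing (hκ z hz) (hΓ z hz) (hkill z hz) (hc z hz) (hc' z hz)
  let X : ℝ → (E →L[ℝ] ℝ) × (E →L[ℝ] E →L[ℝ] ℝ) := fun t =>
    (κ (q + t • (x - q)), fderiv ℝ κ (q + t • (x - q)))
  let X' : ℝ → (E →L[ℝ] ℝ) × (E →L[ℝ] E →L[ℝ] ℝ) := fun t =>
    (fderiv ℝ κ (q + t • (x - q)) (x - q), C (q + t • (x - q)) (x - q))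
  have hX : ∀ t ∈ Set.Icc (0 : ℝ) 1, HasDerivAt X (X' t) t := by
    intro t ht
    have hl : HasDerivAt (fun s : ℝ => q + s • (x - q)) (x - q) t := by
      simpa using ((hasDerivAt_id t).smul_const (x - q)).const_add q
    exact ((((hκ _ (hmem t ht)).differentiableAt (by simp)).hasFDerivAt).comp_hasDerivAt t hl).prodMk
      ((hC _ (hmem t ht)).comp_hasDerivAt t hl)
  have hbound : ∀ t ∈ Set.Ico (0 : ℝ) 1, ‖X' t‖ ≤ ((6 * c + 1) * ‖x - q‖) * ‖X t‖ + 0 := by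
    intro t ht
    have hm := hmem t (Set.Ico_subset_Icc_self ht)
    have n1 : ‖κ (q + t • (x - q))‖ ≤ ‖X t‖ := norm_fst_le (X t)
    have n2 : ‖fderiv ℝ κ (q + t • (x - q))‖ ≤ ‖X t‖ := norm_snd_le (X t)
    have hXn := norm_nonneg (X t)
    rw [add_zero]
    refine max_le ?_ ?_
    · refine (ContinuousLinearMap.le_opNorm _ _).trans ?_
      have : ‖fderiv ℝ κ (q + t • (x - q))‖ * ‖x - q‖ ≤ ‖X t‖ * ‖x - q‖ := by gcongr
      refine this.trans ?_
      have h6 : 0 ≤ 6 * c * (‖x - q‖ * ‖X t‖) := by positivity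
      linarith
    · refine (ContinuousLinearMap.le_opNorm _ _).trans ?_
      have h1 : ‖C (q + t • (x - q))‖ ≤ 3 * c * (‖X t‖ + ‖X t‖) :=
        (hCb _ hm).trans (by gcongr)
      have : ‖C (q + t • (x - q))‖ * ‖x - q‖ ≤ 3 * c * (‖X t‖ + ‖X t‖) * ‖x - q‖ := by gcongr
      refine this.trans ?_
      have h6 : 0 ≤ ‖x - q‖ * ‖X t‖ := by positivity
      linarith
  have hX0 : ‖X 0‖ ≤ max ‖κ q‖ ‖fderiv ℝ κ q‖ := by
    simp [X, Prod.norm_def]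
  have hg := norm_le_gronwallBound_of_norm_deriv_right_le
    (fun t ht => (hX t ht).continuousAt.continuousWithinAt)
    (fun t ht => (hX t (Set.Ico_subset_Icc_self ht)).hasDerivWithinAt) hX0 hbound
  intro z hz
  rw [segment_eq_image'] at hz
  obtain ⟨t, ht, rfl⟩ := hz
  refine (norm_fst_le (X t)).trans ((hg t ht).trans ?_)
  rw [gronwallBound_ε0, sub_zero]
  refine mul_le_mul_of_nonneg_left (Real.exp_le_exp.2 ?_) (by positivity)
  exact mul_le_of_le_one_right (by positivity) ht.2

end Prolongation

/-! ### Segments avoiding sets of small Hausdorff dimension -/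

section Segments

variable {E : Type*} [NormedAddCommGroup E] [NormedSpace ℝ E] [FiniteDimensional ℝ E]

/-- A set of Hausdorff dimension less than `n - 1` does not separate: a point `x` outside it is
joined by segments avoiding it to points arbitrarily close to any given `q₀ ≠ x`. The end points of
the bad segments, on a hyperplane through `q₀` not containing `x`, form the image of the set under
the radial projection from `x`, which does not increase Hausdorff dimension. -/
theorem exists_segment_avoiding {Z : Set E}
    (hZ : dimH Z < ((Module.finrank ℝ E - 1 : ℕ) : ENNReal)) {x q₀ : E} (hx : x ∉ Z)
    (hne : q₀ ≠ x) {ρ : ℝ} (hρ : 0 < ρ) :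
    ∃ q ∈ Metric.ball q₀ ρ, ∀ z ∈ segment ℝ q x, z ∉ Z := by
  have hc : 0 < ‖q₀ - x‖ := norm_pos_iff.2 (sub_ne_zero.2 hne)
  obtain ⟨l, -, hl⟩ := exists_dual_vector ℝ (q₀ - x) hc.ne'
  set c := ‖q₀ - x‖ with hc_def
  simp only [RCLike.ofReal_real_eq_id, id_eq] at hl
  set u := c⁻¹ • (q₀ - x) with hu
  have hlu : l u = 1 := by rw [hu, map_smul, hl, smul_eq_mul, inv_mul_cancel₀ hc.ne']
  let P : E →L[ℝ] LinearMap.ker (l : E →ₗ[ℝ] ℝ) :=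
    (ContinuousLinearMap.id ℝ E - l.smulRight u).codRestrict _ (fun v => by simp [hlu])
  have hP : ∀ w : LinearMap.ker (l : E →ₗ[ℝ] ℝ), P w = w := by
    intro w
    have hw : l (w : E) = 0 := w.2
    ext
    simp [P, hw]
  let F : E → LinearMap.ker (l : E →ₗ[ℝ] ℝ) := fun z => P (x + (c / l (z - x)) • (z - x) - q₀)
  let s : Set E := {z | 0 < l (z - x)}
  have hs : Convex ℝ s := by
    have : s = {z | l x < l z} := by ext z; simp [s]
    rw [this]
    exact convex_halfSpace_gt l.isLinear _
  have hF : ContDiffOn ℝ 1 F s := by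
    refine P.contDiff.comp_contDiffOn ?_
    refine ContDiffOn.sub (contDiffOn_const.add (ContDiffOn.smul ?_ ?_)) contDiffOn_const
    · refine contDiffOn_const.div ?_ (fun z hz => (ne_of_gt hz))
      exact l.contDiff.comp_contDiffOn (contDiffOn_id.sub contDiffOn_const)
    · exact contDiffOn_id.sub contDiffOn_const
  have hdim : dimH (F '' (Z ∩ s)) < Module.finrank ℝ (LinearMap.ker (l : E →ₗ[ℝ] ℝ)) := by
    have h1 : dimH (F '' (Z ∩ s)) ≤ dimH (Z ∩ s) := hF.dimH_image_le hs Set.inter_subset_right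
    have h2 : dimH (Z ∩ s) ≤ dimH Z := dimH_mono Set.inter_subset_left
    have hl0 : (l : E →ₗ[ℝ] ℝ) ≠ 0 := by
      intro h0
      have : l u = 0 := congrArg (fun L : E →ₗ[ℝ] ℝ => L u) h0
      rw [hlu] at this
      exact one_ne_zero this
    have h3 := Module.Dual.finrank_ker_add_one_of_ne_zero (K := ℝ) (V₁ := E) hl0
    have h4 : Module.finrank ℝ E - 1 = Module.finrank ℝ (LinearMap.ker (l : E →ₗ[ℝ] ℝ)) := by omega
    rw [h4] at hZ
    exact (h1.trans h2).trans_lt hZ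
  obtain ⟨w, hw, hwρ⟩ := (dense_compl_of_dimH_lt_finrank hdim).exists_dist_lt 0 hρ
  refine ⟨q₀ + w, ?_, ?_⟩
  · rw [dist_zero_left] at hwρ
    simpa using hwρ
  · intro z hz hzZ
    rw [segment_symm, segment_eq_image'] at hz
    obtain ⟨t, ht, rfl⟩ := hz
    rcases ht.1.eq_or_lt with rfl | htp
    · simp at hzZ; exact hx hzZ
    have hlw : l (w : E) = 0 := w.2
    have hlz : l (q₀ + w - x) = c := by
      rw [add_sub_right_comm, map_add, hl, hlw, add_zero]
    refine hw ⟨_, ⟨hzZ, ?_⟩, ?_⟩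
    · simp only [s, Set.mem_ofPred_eq, add_sub_cancel_left, map_smul, hlz, smul_eq_mul]
      positivity
    · simp only [F, add_sub_cancel_left, map_smul, hlz, smul_eq_mul, smul_smul]
      have h1 : c / (t * c) * t = 1 := by field_simp
      rw [h1, one_smul]
      have h2 : x + (q₀ + (w : E) - x) - q₀ = w := by abel
      rw [h2, hP]

end Segments

/-! ### The local theorem in a real chart -/

section LocalTheorem

variable {E : Type*} [NormedAddCommGroup E] [NormedSpace ℝ E] {U : Set E} {G : E → E →L[ℝ] E →L[ℝ] ℝ} {J : E → E →L[ℝ] E} {f : E → ℝ} {y : E}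

theorem contDiffAt_killingForm (hf : ContDiffAt ℝ 2 f y) (hf0 : f y ≠ 0)
    (hJ : ContDiffAt ℝ 1 J y) : ContDiffAt ℝ 1 (killingForm f J) y :=
  ((hf.of_le (by norm_num)).inv hf0).smul
    ((contDiffAt_logDifferential hf hf0 (by norm_num)).clm_comp hJ)

theorem hasFDerivAt_inv_killingForm (hf : DifferentiableAt ℝ f y) (hf0 : f y ≠ 0)
    (hJ2 : ∀ v, J y (J y v) = - v) :
    HasFDerivAt (fun x => (f x)⁻¹) ((killingForm f J y).comp (J y)) y := by
  refine ((hasDerivAt_inv hf0).comp_hasFDerivAt y hf.hasFDerivAt).congr_fderiv ?_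
  ext v
  simp only [killingForm, logDifferential, smul_apply, ContinuousLinearMap.comp_apply, hJ2,
    map_neg, smul_eq_mul]
  field_simp

variable [FiniteDimensional ℝ E]

/-- The Killing equation for `killingForm`. -/
theorem killingForm_killing (hn : 2 < Module.finrank ℝ E) (hU : IsOpen U)
    (hGi : ∀ y ∈ U, IsInner (G y)) (hG : ContDiffOn ℝ 2 G U) (hJ : ContDiffOn ℝ 1 J U)
    (hJ2 : ∀ y ∈ U, ∀ v, J y (J y v) = - v)
    (hinv : ∀ y ∈ U, ∀ v w, G y (J y v) (J y w) = G y v w)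
    (hRic : ∀ y ∈ U, ∀ v w, coordRicci G y (J y v) (J y w) = coordRicci G y v w)
    (hf : ∀ y ∈ U, ContDiffAt ℝ 2 f y) (hf0 : ∀ y ∈ U, f y ≠ 0)
    (hpar : ∀ y ∈ U, ∀ v w,
      fderiv ℝ J y v w = J y (christoffel (fun x => f x ^ 2 • G x) y v w)
        - christoffel (fun x => f x ^ 2 • G x) y v (J y w)) (hy : y ∈ U) (v w : E) :
    fderiv ℝ (killingForm f J) y v w + fderiv ℝ (killingForm f J) y w v =
      2 * killingForm f J y (christoffel G y v w) := by
  have hUy := hU.mem_nhds hy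
  have hGy : ContDiffAt ℝ 2 G y := hG.contDiffAt hUy
  have hGe : ∀ᶠ x in nhds y, IsInner (G x) := Filter.eventually_of_mem hUy hGi
  have hJe : ∀ᶠ x in nhds y, DifferentiableAt ℝ J x := by
    filter_upwards [hUy] with x hx
    exact (hJ.contDiffAt (hU.mem_nhds hx)).differentiableAt (by simp)
  have hRg : ∀ v w, coordRicci (fun x => f x ^ 2 • G x) y (J y v) (J y w) =
      coordRicci (fun x => f x ^ 2 • G x) y v w := by
    refine coordRicci_invariant_of_parallel (((hf y hy).pow 2).smul hGy) ?_ hJe ?_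
      (Filter.eventually_of_mem hUy hpar)
    · filter_upwards [hUy] with x hx using (hGi x hx).smul_sq (hf0 x hx)
    · intro v w
      simp [hinv y hy v w]
  have hc := conformalHessian_invariant hn hGe hGy (hf y hy) (hf0 y hy) (hinv y hy) (hRic y hy) hRg
  have hk := killingForm_killing_self hGe hGy (hf y hy) (hf0 y hy) hJe.self_of_nhds (hJ2 y hy)
    (hinv y hy) (hpar y hy) hc
  have h1 := hk v
  have h2 := hk w
  have h3 := hk (v + w)
  have h4 := christoffel_symm hGe.self_of_nhds (hGy.differentiableAt (by simp))
    (hGe.mono fun z hz => hz.symm) w v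
  simp only [map_add, add_apply, h4] at h3
  linarith

/-- The local form of the theorem, in a real coordinate chart. The bound on the Killing form along
generic segments bounds `1 / f` near a hypothetical zero of `f`. -/
theorem ne_zero_of_parallel (hn : 2 < Module.finrank ℝ E) (hU : IsOpen U)
    (hGi : ∀ y ∈ U, IsInner (G y)) (hG : ContDiffOn ℝ 2 G U) (hJ : ContDiffOn ℝ 1 J U)
    (hJ2 : ∀ y ∈ U, ∀ v, J y (J y v) = - v)
    (hinv : ∀ y ∈ U, ∀ v w, G y (J y v) (J y w) = G y v w)
    (hRic : ∀ y ∈ U, ∀ v w, coordRicci G y (J y v) (J y w) = coordRicci G y v w)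
    (hfc : ContinuousOn f U) (hf : ∀ y ∈ U, f y ≠ 0 → ContDiffAt ℝ 2 f y)
    (hpar : ∀ y ∈ U, f y ≠ 0 → ∀ v w,
      fderiv ℝ J y v w = J y (christoffel (fun x => f x ^ 2 • G x) y v w)
        - christoffel (fun x => f x ^ 2 • G x) y v (J y w))
    (hdim : dimH (U ∩ {y | f y = 0}) < ((Module.finrank ℝ E - 1 : ℕ) : ENNReal))
    {p : E} (hp : p ∈ U) : f p ≠ 0 := by
  intro hp0
  set V : Set E := U ∩ {y | f y ≠ 0} with hV
  have hVo : IsOpen V := hfc.isOpen_inter_preimage hU isOpen_ne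
  have hVU : V ⊆ U := Set.inter_subset_left
  have hΓ : ∀ y ∈ U, ContDiffAt ℝ 1 (christoffel G) y := fun y hy =>
    contDiffAt_christoffel (hGi y hy) (hG.contDiffAt (hU.mem_nhds hy)) (by norm_num)
  have hκ : ∀ y ∈ V, ContDiffAt ℝ 1 (killingForm f J) y := fun y hy =>
    contDiffAt_killingForm (hf y hy.1 hy.2) hy.2 (hJ.contDiffAt (hU.mem_nhds hy.1))
  have hkill : ∀ y ∈ V, ∀ v w,
      fderiv ℝ (killingForm f J) y v w + fderiv ℝ (killingForm f J) y w v =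
        2 * killingForm f J y (christoffel G y v w) := fun y hy v w =>
    killingForm_killing hn hVo (fun y hy => hGi y hy.1) (hG.mono hVU) (hJ.mono hVU)
      (fun y hy => hJ2 y hy.1) (fun y hy => hinv y hy.1) (fun y hy => hRic y hy.1)
      (fun y hy => hf y hy.1 hy.2) (fun y hy => hy.2) (fun y hy => hpar y hy.1 hy.2) hy v w
  -- Local bounds for the connection, its derivative and `J` near `p`.
  obtain ⟨c, hc⟩ : ∃ c : ℝ, ∀ᶠ x in nhds p,
      ‖christoffel G x‖ ≤ c ∧ ‖fderiv ℝ (christoffel G) x‖ ≤ c ∧ ‖J x‖ ≤ c := by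
    have c1 : ContinuousAt (christoffel G) p := (hΓ p hp).continuousAt
    have c2 : ContinuousAt (fderiv ℝ (christoffel G)) p :=
      ((hΓ p hp).fderiv_right (m := 0) (by norm_num)).continuousAt
    have c3 : ContinuousAt J p := (hJ.contDiffAt (hU.mem_nhds hp)).continuousAt
    refine ⟨max ‖christoffel G p‖ (max ‖fderiv ℝ (christoffel G) p‖ ‖J p‖) + 1, ?_⟩
    filter_upwards [c1.norm.eventually_lt_const (lt_add_one _),
      c2.norm.eventually_lt_const (lt_add_one _), c3.norm.eventually_lt_const (lt_add_one _)]
      with x h1 h2 h3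
    refine ⟨h1.le.trans ?_, h2.le.trans ?_, h3.le.trans ?_⟩ <;> gcongr <;> simp
  obtain ⟨R, hR, hball⟩ := Metric.mem_nhds_iff.1 (Filter.inter_mem (hU.mem_nhds hp) hc)
  have hdense : Dense (U ∩ {y | f y = 0})ᶜ := by
    refine dense_compl_of_dimH_lt_finrank (hdim.trans_le ?_)
    exact_mod_cast Nat.sub_le _ _
  have hcV : ∀ z ∈ Metric.ball p R, z ∉ U ∩ {y | f y = 0} → z ∈ V := fun z hz hzZ =>
    ⟨(hball hz).1, fun h0 => hzZ ⟨(hball hz).1, h0⟩⟩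
  obtain ⟨q₀, hq₀Z, hq₀R⟩ := hdense.exists_mem_open Metric.isOpen_ball ⟨p, Metric.mem_ball_self hR⟩
  have hq₀V := hcV q₀ hq₀R hq₀Z
  have hpq : p ≠ q₀ := fun h => hq₀V.2 (h ▸ hp0)
  -- Local bounds for the first jet of the Killing form and for `1 / f` near `q₀`.
  obtain ⟨d, hd⟩ : ∃ d : ℝ, ∀ᶠ x in nhds q₀, ‖killingForm f J x‖ ≤ d ∧
      ‖fderiv ℝ (killingForm f J) x‖ ≤ d ∧ ‖(f x)⁻¹‖ ≤ d := by
    have c1 : ContinuousAt (killingForm f J) q₀ := (hκ q₀ hq₀V).continuousAt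
    have c2 : ContinuousAt (fderiv ℝ (killingForm f J)) q₀ :=
      ((hκ q₀ hq₀V).fderiv_right (m := 0) (by norm_num)).continuousAt
    have c3 : ContinuousAt (fun x => (f x)⁻¹) q₀ :=
      (hf q₀ hq₀V.1 hq₀V.2).continuousAt.inv₀ hq₀V.2
    refine ⟨max ‖killingForm f J q₀‖ (max ‖fderiv ℝ (killingForm f J) q₀‖ ‖(f q₀)⁻¹‖) + 1, ?_⟩
    filter_upwards [c1.norm.eventually_lt_const (lt_add_one _),
      c2.norm.eventually_lt_const (lt_add_one _), c3.norm.eventually_lt_const (lt_add_one _)]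
      with x h1 h2 h3
    refine ⟨h1.le.trans ?_, h2.le.trans ?_, h3.le.trans ?_⟩ <;> gcongr <;> simp
  obtain ⟨ρ, hρ, hballρ⟩ := Metric.mem_nhds_iff.1
    (Filter.inter_mem (Metric.isOpen_ball.mem_nhds hq₀R) hd)
  have hc0 : 0 ≤ c := (norm_nonneg _).trans (hball (Metric.mem_ball_self hR)).2.1
  have hd0 : 0 ≤ d := (norm_nonneg _).trans (hballρ (Metric.mem_ball_self hρ)).2.1
  set K : ℝ := d + d * Real.exp ((6 * c + 1) * (2 * R)) * c * (2 * R) with hK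
  have hbound : ∀ x ∈ Metric.ball p R, x ∈ V → x ≠ q₀ → ‖(f x)⁻¹‖ ≤ K := by
    intro x hxR hxV hxq
    obtain ⟨q, hq, hqx⟩ := exists_segment_avoiding hdim (x := x) (fun h => hxV.2 h.2) hxq.symm hρ
    have hqR := (hballρ hq).1
    have hsR : segment ℝ q x ⊆ Metric.ball p R := (convex_ball p R).segment_subset hqR hxR
    have hsV : segment ℝ q x ⊆ V := fun z hz => hcV z (hsR hz) (hqx z hz)
    have hxq2 : ‖x - q‖ ≤ 2 * R := by
      rw [← dist_eq_norm]
      have h1 := dist_triangle_right x q p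
      rw [Metric.mem_ball] at hqR hxR
      linarith
    have hκb := norm_le_of_killing_segment (fun z hz => hκ z (hsV hz))
      (fun z hz => hΓ z (hsV hz).1)
      (fun z hz => Filter.eventually_of_mem (hVo.mem_nhds (hsV hz)) hkill)
      (fun z hz => (hball (hsR hz)).2.1) (fun z hz => (hball (hsR hz)).2.2.1)
    have hmv := (convex_segment q x).norm_image_sub_le_of_norm_hasFDerivWithin_le (𝕜 := ℝ)
      (f := fun x => (f x)⁻¹) (f' := fun z => (killingForm f J z).comp (J z))
      (C := d * Real.exp ((6 * c + 1) * (2 * R)) * c)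
      (fun z hz => (hasFDerivAt_inv_killingForm ((hf z (hsV hz).1 (hsV hz).2).differentiableAt
        (by simp)) (hsV hz).2 (hJ2 z (hsV hz).1)).hasFDerivWithinAt) ?_
      (left_mem_segment ℝ q x) (right_mem_segment ℝ q x)
    · have h1 : ‖(f x)⁻¹‖ ≤ ‖(f q)⁻¹‖ + ‖(f x)⁻¹ - (f q)⁻¹‖ := norm_le_norm_add_norm_sub' _ _
      have h2 : d * Real.exp ((6 * c + 1) * (2 * R)) * c * ‖x - q‖ ≤
          d * Real.exp ((6 * c + 1) * (2 * R)) * c * (2 * R) := by gcongr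
      have h3 : ‖(f q)⁻¹‖ ≤ d := (hballρ hq).2.2.2
      linarith
    · intro z hz
      refine (ContinuousLinearMap.opNorm_comp_le _ _).trans ?_
      have h1 : max ‖killingForm f J q‖ ‖fderiv ℝ (killingForm f J) q‖ ≤ d :=
        max_le (hballρ hq).2.1 (hballρ hq).2.2.1
      have h2 : ‖killingForm f J z‖ ≤ d * Real.exp ((6 * c + 1) * (2 * R)) := by
        refine (hκb z hz).trans ?_
        gcongr
      have h3 : ‖J z‖ ≤ c := (hball (hsR hz)).2.2.2
      gcongr
  -- Points outside the zero set tending to `p` contradict this bound.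
  have hK0 : 0 ≤ K := by positivity
  have hfp : ∀ᶠ x in nhds p, ‖f x‖ < (K + 1)⁻¹ := by
    have h1 : ContinuousAt f p := hfc.continuousAt (hU.mem_nhds hp)
    have h2 := h1.norm
    refine h2.eventually_lt_const ?_
    simp only [hp0, norm_zero]
    positivity
  obtain ⟨s, hs, hso, hps⟩ := eventually_nhds_iff.1
    ((hfp.and (isOpen_ne.mem_nhds hpq)).and (Metric.isOpen_ball.mem_nhds
      (Metric.mem_ball_self (x := p) hR)))
  obtain ⟨x, hxZ, hxs⟩ := hdense.exists_mem_open hso ⟨p, hps⟩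
  obtain ⟨⟨hx1, hx2⟩, hxR⟩ := hs x hxs
  have hxV := hcV x hxR hxZ
  have h1 := hbound x hxR hxV hx2
  have hfx : 0 < ‖f x‖ := norm_pos_iff.2 hxV.2
  rw [norm_inv] at h1
  have h2 : K + 1 < ‖f x‖⁻¹ := by
    rw [lt_inv_comm₀ (by positivity) hfx]
    exact hx1
  linarith

end LocalTheorem

/-! ### Kähler metrics in holomorphic coordinates -/

section HolomorphicCoordinates

variable {E : Type*} [NormedAddCommGroup E] [NormedSpace ℂ E]

variable (E) in
/-- Multiplication by `i`, as a real-linear map. -/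
noncomputable def mulI : E →L[ℝ] E := Complex.I • ContinuousLinearMap.id ℝ E

theorem mulI_mulI (v : E) : mulI E (mulI E v) = - v := by
  simp [mulI, smul_smul]

variable [FiniteDimensional ℂ E]

/-- In holomorphic coordinates, the Christoffel symbols of a Hermitian metric whose fundamental
form is closed are complex linear. -/
theorem christoffel_mulI {g : E → E →L[ℝ] E →L[ℝ] ℝ} {z : E} (hd : DifferentiableAt ℝ g z)
    (hg : ∀ᶠ x in nhds z, IsInner (g x))
    (hinv : ∀ᶠ x in nhds z, ∀ v w, g x (mulI E v) (mulI E w) = g x v w)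
    (hclosed : ∀ u v w, coordExtDeriv (fun x => (g x).comp (mulI E)) z u v w = 0) (v w : E) :
    christoffel g z v (mulI E w) = mulI E (christoffel g z v w) := by
  have hgz := hg.self_of_nhds
  have hs : ∀ᶠ x in nhds z, ∀ v w, g x v w = g x w v := hg.mono fun z hz => hz.symm
  have hskew : ∀ᶠ x in nhds z, ∀ v w, g x (mulI E v) w = - g x v (mulI E w) := by
    filter_upwards [hinv] with x hx v w
    have := hx v (mulI E w)
    rw [mulI_mulI, map_neg] at this
    linarith
  have hDskew : ∀ u v w, fderiv ℝ g z u (mulI E v) w = - fderiv ℝ g z u v (mulI E w) := by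
    intro u v w
    have h1 : HasFDerivAt (fun x => g x (mulI E v) w) _ z :=
      (hd.hasFDerivAt.clm_apply (hasFDerivAt_const _ z)).clm_apply (hasFDerivAt_const w z)
    have h2 : HasFDerivAt (fun x => - g x v (mulI E w)) _ z :=
      ((hd.hasFDerivAt.clm_apply (hasFDerivAt_const v z)).clm_apply (hasFDerivAt_const _ z)).neg
    have h3 := h1.unique (h2.congr_of_eventuallyEq (hskew.mono fun x hx => hx v w))
    simpa using congrArg (fun L : E →L[ℝ] ℝ => L u) h3
  have hω : ∀ u v w, fderiv ℝ g z u (mulI E v) w + fderiv ℝ g z v (mulI E w) u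
      + fderiv ℝ g z w (mulI E u) v = 0 := by
    intro u v w
    have h1 : HasFDerivAt (fun x => (g x).comp (mulI E)) _ z :=
      hd.hasFDerivAt.clm_comp (hasFDerivAt_const (mulI E) z)
    have h2 := hclosed u v w
    rw [coordExtDeriv, h1.fderiv] at h2
    simpa using h2
  have hDs := fderiv_symm hd hs
  refine hgz.ext fun u => ?_
  have e1 := christoffel_spec hgz v (mulI E w) u
  have e2 := christoffel_spec hgz v w (mulI E u)
  have e3 := hskew.self_of_nhds (christoffel g z v w) u
  -- The two sides differ by a combination of the components `(v, w, u)` and `(v, iw, iu)` of `dω`.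
  have k1 := hω v w u
  have k2 := hω v (mulI E w) (mulI E u)
  simp only [mulI_mulI, map_neg, neg_apply] at k2
  have d1 := hDskew v w u
  have d2 := hDskew w v u
  have d3 := hDskew u v w
  have d4 := hDskew (mulI E u) v (mulI E w)
  have d5 := hDs (mulI E w) v u
  have d6 := hDs w v (mulI E u)
  rw [mulI_mulI, map_neg, neg_neg] at d4
  linarith

/-- Parallelism of the complex structure in real coordinates `y`, related to holomorphic coordinates
by a `C²` change of coordinates `τ`. The connection of the pulled-back metric `g` satisfies the usual
transformation law, and differentiating `Dτ ∘ J = i ∘ Dτ` gives the result if the Christoffel symbols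
in the holomorphic coordinates are complex linear. -/
theorem fderiv_complexStructure_eq {τ : E → E} {y : E} {gc g : E → E →L[ℝ] E →L[ℝ] ℝ}
    {J : E → E →L[ℝ] E} (hτ : ContDiffAt ℝ 2 τ y) (hT : (fderiv ℝ τ y).IsInvertible)
    (hgc : DifferentiableAt ℝ gc (τ y)) (hgci : ∀ᶠ x in nhds (τ y), IsInner (gc x))
    (hg : DifferentiableAt ℝ g y) (hgi : IsInner (g y))
    (hpull : ∀ᶠ x in nhds y, ∀ v w, g x v w = gc (τ x) (fderiv ℝ τ x v) (fderiv ℝ τ x w))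
    (hJ : DifferentiableAt ℝ J y)
    (hTJ : ∀ᶠ x in nhds y, ∀ v, fderiv ℝ τ x (J x v) = mulI E (fderiv ℝ τ x v))
    (hΓ : ∀ v w, christoffel gc (τ y) v (mulI E w) = mulI E (christoffel gc (τ y) v w)) (v w : E) :
    fderiv ℝ J y v w = J y (christoffel g y v w) - christoffel g y v (J y w) := by
  have hTd : DifferentiableAt ℝ (fderiv ℝ τ) y :=
    (hτ.fderiv_right (m := 1) (by norm_num)).differentiableAt (by simp)
  have hτd : DifferentiableAt ℝ τ y := hτ.differentiableAt (by simp)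
  have hgcs : ∀ᶠ x in nhds (τ y), ∀ v w, gc x v w = gc x w v := hgci.mono fun z hz => hz.symm
  set T := fderiv ℝ τ y with hT_def
  set DT := fderiv ℝ (fderiv ℝ τ) y with hDT
  have hDTs : ∀ v w, DT v w = DT w v := by
    refine second_derivative_symmetric_of_eventually (𝕜 := ℝ) (f := τ) ?_ hTd.hasFDerivAt
    filter_upwards [hτ.eventually (by simp)] with x hx
    exact (hx.differentiableAt (by simp)).hasFDerivAt
  have hTi : ∀ v, T (T.inverse v) = v := fun v => hT.self_apply_inverse v
  have hinj : Function.Injective T := hT.injective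
  let Γ' : E → E → E := fun v w => T.inverse (DT v w + christoffel gc (τ y) (T v) (T w))
  -- The transformation law: `Γ'` is symmetric and metric.
  have hΓ' : ∀ v w, christoffel g y v w = Γ' v w := by
    refine eq_christoffel hgi (T := Γ') ?_ ?_
    · intro v w
      simp only [Γ', hDTs v w, christoffel_symm hgci.self_of_nhds hgc hgcs (T v) (T w)]
    · intro u v w
      have cv := hasFDerivAt_const (𝕜 := ℝ) v y
      have cw := hasFDerivAt_const (𝕜 := ℝ) w y
      have h1 : HasFDerivAt (fun x => g x v w) _ y :=
        (hg.hasFDerivAt.clm_apply cv).clm_apply cw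
      have h2 : HasFDerivAt (fun x => gc (τ x) (fderiv ℝ τ x v) (fderiv ℝ τ x w)) _ y :=
        ((hgc.hasFDerivAt.comp y hτd.hasFDerivAt).clm_apply (hTd.hasFDerivAt.clm_apply cv)).clm_apply
          (hTd.hasFDerivAt.clm_apply cw)
      have h3 := h1.unique (h2.congr_of_eventuallyEq (hpull.mono fun x hx => hx v w))
      have h4 := congrArg (fun L : E →L[ℝ] ℝ => L u) h3
      simp at h4
      rw [h4, hpull.self_of_nhds, hpull.self_of_nhds]
      simp only [← hT_def, ← hDT, Γ', hTi, map_add, add_apply]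
      rw [fderiv_eq_christoffel hgci.self_of_nhds hgc hgcs]
      ring
  have hTΓ : ∀ v w, T (christoffel g y v w) = DT v w + christoffel gc (τ y) (T v) (T w) := by
    intro v w; rw [hΓ' v w, hTi]
  have hTJy : ∀ v, T (J y v) = mulI E (T v) := hTJ.self_of_nhds
  have hder : DT v (J y w) + T (fderiv ℝ J y v w) = mulI E (DT v w) := by
    have cw := hasFDerivAt_const (𝕜 := ℝ) w y
    have h1 : HasFDerivAt (fun x => fderiv ℝ τ x (J x w)) _ y :=
      hTd.hasFDerivAt.clm_apply (hJ.hasFDerivAt.clm_apply cw)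
    have h2 : HasFDerivAt (fun x => mulI E (fderiv ℝ τ x w)) _ y :=
      (mulI E).hasFDerivAt.comp y (hTd.hasFDerivAt.clm_apply cw)
    have h3 := h1.unique (h2.congr_of_eventuallyEq (hTJ.mono fun x hx => hx w))
    have h4 := congrArg (fun L : E →L[ℝ] E => L v) h3
    simp at h4
    rw [← h4]; abel
  apply hinj
  rw [map_sub, hTJy, hTΓ, hTΓ, hTJy, hΓ, map_add, ← hder]
  abel

end HolomorphicCoordinates

/-! ### Tensor fields in charts -/

section Charts

variable {E : Type*} [NormedAddCommGroup E] [NormedSpace ℂ E]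
  {M : Type*} [TopologicalSpace M] [ChartedSpace E M]

variable (E M) in
theorem isManifold_real [IsManifold 𝓘(ℂ, E) ω M] : IsManifold 𝓘(ℝ, E) 2 M := by
  refine isManifold_of_contDiffOn _ _ _ fun e e' he he' => ?_
  have h1 : e.symm ≫ₕ e' ∈ contDiffGroupoid ω 𝓘(ℂ, E) :=
    StructureGroupoid.compatible _ he he'
  have h2 := contMDiffOn_iff_contDiffOn.1 (contMDiffOn_of_mem_contDiffGroupoid h1)
  have h3 := (h2.of_le (m := 2) le_top).restrict_scalars ℝ
  simpa using h3

/-- The derivative of the inverse of a chart at `y`, with the tangent space at the image point read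
in the preferred holomorphic chart there. -/
noncomputable def chartFrame (e : OpenPartialHomeomorph M E) (y : E) : E →L[ℝ] E :=
  fderiv ℝ (chartAt E (e.symm y) ∘ e.symm) y

theorem contDiffOn_transition {e e' : OpenPartialHomeomorph M E}
    (he : e ∈ IsManifold.maximalAtlas 𝓘(ℝ, E) 2 M) (he' : e' ∈ IsManifold.maximalAtlas 𝓘(ℝ, E) 2 M) :
    ContDiffOn ℝ 2 (e' ∘ e.symm) (e.symm ≫ₕ e').source :=
  contMDiffOn_iff_contDiffOn.1 (contMDiffOn_of_mem_contDiffGroupoid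
    (StructureGroupoid.compatible_of_mem_maximalAtlas he he'))

theorem mfderiv_symm_eq_chartFrame {e : OpenPartialHomeomorph M E}
    (he : e ∈ IsManifold.maximalAtlas 𝓘(ℝ, E) 2 M) {y : E} (hy : y ∈ e.target) :
    (mfderiv 𝓘(ℝ, E) 𝓘(ℝ, E) e.symm y : E →L[ℝ] E) = chartFrame e y := by
  have h1 : MDifferentiableAt 𝓘(ℝ, E) 𝓘(ℝ, E) e.symm y :=
    ((contMDiffOn_symm_of_mem_maximalAtlas he).contMDiffAt
      (e.open_target.mem_nhds hy)).mdifferentiableAt (by simp)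
  have h2 : ∀ L : E →L[ℝ] E, HasFDerivWithinAt (chartAt E (e.symm y) ∘ e.symm) L
      (Set.range (id : E → E)) y → L = chartFrame e y := by
    intro L hL
    rw [Set.range_id, hasFDerivWithinAt_univ] at hL
    exact hL.fderiv.symm
  exact h2 _ h1.hasMFDerivAt.2

theorem inChart_apply {e : OpenPartialHomeomorph M E}
    (he : e ∈ IsManifold.maximalAtlas 𝓘(ℝ, E) 2 M) {y : E} (hy : y ∈ e.target) (b : BilinField E M)
    (v w : E) :
    inChart e b y v w =
      (b (e.symm y) : E →L[ℝ] E →L[ℝ] ℝ) (chartFrame e y v) (chartFrame e y w) := by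
  rw [← mfderiv_symm_eq_chartFrame he hy]
  rfl

theorem fderiv_transition_comp {e e' : OpenPartialHomeomorph M E}
    (he : e ∈ IsManifold.maximalAtlas 𝓘(ℝ, E) 2 M)
    (he' : e' ∈ IsManifold.maximalAtlas 𝓘(ℝ, E) 2 M) {y : E} (hy : y ∈ (e.symm ≫ₕ e').source) :
    (fderiv ℝ (e ∘ e'.symm) (e' (e.symm y))).comp (fderiv ℝ (e' ∘ e.symm) y) =
      ContinuousLinearMap.id ℝ E := by
  have h1 : DifferentiableAt ℝ (e' ∘ e.symm) y :=
    ((contDiffOn_transition he he').contDiffAt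
      ((e.symm ≫ₕ e').open_source.mem_nhds hy)).differentiableAt (by simp)
  have hy' : e' (e.symm y) ∈ (e'.symm ≫ₕ e).source := by
    have := (e.symm ≫ₕ e').map_source hy
    simpa using this
  have h2 : DifferentiableAt ℝ (e ∘ e'.symm) ((e' ∘ e.symm) y) :=
    ((contDiffOn_transition he' he).contDiffAt
      ((e'.symm ≫ₕ e).open_source.mem_nhds hy')).differentiableAt (by simp)
  have h3 := fderiv_comp y h2 h1
  refine h3.symm.trans ?_
  have hev : (e ∘ e'.symm) ∘ (e' ∘ e.symm) =ᶠ[nhds y] id := by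
    filter_upwards [(e.symm ≫ₕ e').open_source.mem_nhds hy] with x hx
    have hx' : x ∈ e.target ∧ e.symm x ∈ e'.source := by simpa using hx
    simp [e'.left_inv hx'.2, e.right_inv hx'.1]
  rw [hev.fderiv_eq, fderiv_id]

theorem isInvertible_fderiv_transition {e e' : OpenPartialHomeomorph M E}
    (he : e ∈ IsManifold.maximalAtlas 𝓘(ℝ, E) 2 M)
    (he' : e' ∈ IsManifold.maximalAtlas 𝓘(ℝ, E) 2 M) {y : E} (hy : y ∈ (e.symm ≫ₕ e').source) :
    (fderiv ℝ (e' ∘ e.symm) y).IsInvertible := by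
  have hy0 : y ∈ e.target ∧ e.symm y ∈ e'.source := by simpa using hy
  have hy' : e' (e.symm y) ∈ (e'.symm ≫ₕ e).source := by
    have := (e.symm ≫ₕ e').map_source hy
    simpa using this
  have h1 := fderiv_transition_comp he' he hy'
  rw [e'.left_inv hy0.2, e.right_inv hy0.1] at h1
  exact ContinuousLinearMap.IsInvertible.of_inverse h1 (fderiv_transition_comp he he' hy)

variable [IsManifold 𝓘(ℂ, E) ω M]

theorem mem_maximalAtlas_real {e : OpenPartialHomeomorph M E} (he : e ∈ atlas E M) :
    e ∈ IsManifold.maximalAtlas 𝓘(ℝ, E) 2 M :=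
  haveI := isManifold_real E M
  IsManifold.subset_maximalAtlas he

theorem isInvertible_chartFrame {e : OpenPartialHomeomorph M E}
    (he : e ∈ IsManifold.maximalAtlas 𝓘(ℝ, E) 2 M) {y : E} (hy : y ∈ e.target) :
    (chartFrame e y).IsInvertible :=
  isInvertible_fderiv_transition he (mem_maximalAtlas_real (chart_mem_atlas E _)) (by simp [hy])

/-- The frame of a holomorphic chart is complex linear. -/
theorem chartFrame_mulI {e : OpenPartialHomeomorph M E} (he : e ∈ atlas E M) {y : E}
    (hy : y ∈ e.target) (v : E) : chartFrame e y (mulI E v) = mulI E (chartFrame e y v) := by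
  have h1 : e.symm ≫ₕ chartAt E (e.symm y) ∈ contDiffGroupoid ω 𝓘(ℂ, E) :=
    StructureGroupoid.compatible _ he (chart_mem_atlas E _)
  have h2 := contMDiffOn_iff_contDiffOn.1 (contMDiffOn_of_mem_contDiffGroupoid h1)
  have h3 : DifferentiableAt ℂ (chartAt E (e.symm y) ∘ e.symm) y :=
    (h2.contDiffAt ((e.symm ≫ₕ chartAt E (e.symm y)).open_source.mem_nhds
      (by simp [hy]))).differentiableAt (by simp)
  rw [chartFrame, h3.fderiv_restrictScalars ℝ]
  simp [mulI]

theorem chartFrame_comp {e e' : OpenPartialHomeomorph M E}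
    (he : e ∈ IsManifold.maximalAtlas 𝓘(ℝ, E) 2 M)
    (he' : e' ∈ IsManifold.maximalAtlas 𝓘(ℝ, E) 2 M) {y : E} (hy : y ∈ (e.symm ≫ₕ e').source) :
    chartFrame e y = (chartFrame e' (e' (e.symm y))).comp (fderiv ℝ (e' ∘ e.symm) y) := by
  have hy0 : y ∈ e.target ∧ e.symm y ∈ e'.source := by simpa using hy
  have hc : chartAt E (e.symm y) ∈ IsManifold.maximalAtlas 𝓘(ℝ, E) 2 M :=
    mem_maximalAtlas_real (chart_mem_atlas E _)
  have h1 : DifferentiableAt ℝ (e' ∘ e.symm) y :=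
    ((contDiffOn_transition he he').contDiffAt
      ((e.symm ≫ₕ e').open_source.mem_nhds hy)).differentiableAt (by simp)
  have h2 : DifferentiableAt ℝ (chartAt E (e.symm y) ∘ e'.symm) ((e' ∘ e.symm) y) :=
    ((contDiffOn_transition he' hc).contDiffAt
      ((e'.symm ≫ₕ chartAt E (e.symm y)).open_source.mem_nhds
      (by simp [e'.map_source hy0.2, e'.left_inv hy0.2]))).differentiableAt (by simp)
  have h3 := fderiv_comp y h2 h1
  unfold chartFrame
  rw [e'.left_inv hy0.2]
  refine Eq.trans ?_ h3
  refine Filter.EventuallyEq.fderiv_eq ?_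
  filter_upwards [(e.symm ≫ₕ e').open_source.mem_nhds hy] with x hx
  have hx' : x ∈ e.target ∧ e.symm x ∈ e'.source := by simpa using hx
  simp [e'.left_inv hx'.2]

theorem inChart_transition {e e' : OpenPartialHomeomorph M E}
    (he : e ∈ IsManifold.maximalAtlas 𝓘(ℝ, E) 2 M)
    (he' : e' ∈ IsManifold.maximalAtlas 𝓘(ℝ, E) 2 M) {y : E} (hy : y ∈ (e.symm ≫ₕ e').source)
    (b : BilinField E M) (v w : E) :
    inChart e b y v w = inChart e' b (e' (e.symm y))
      (fderiv ℝ (e' ∘ e.symm) y v) (fderiv ℝ (e' ∘ e.symm) y w) := by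
  have hy0 : y ∈ e.target ∧ e.symm y ∈ e'.source := by simpa using hy
  rw [inChart_apply he hy0.1, inChart_apply he' (e'.map_source hy0.2), chartFrame_comp he he' hy,
    e'.left_inv hy0.2]
  rfl

theorem isInner_inChart {e : OpenPartialHomeomorph M E}
    (he : e ∈ IsManifold.maximalAtlas 𝓘(ℝ, E) 2 M) {y : E} (hy : y ∈ e.target) {b : BilinField E M}
    (hs : ∀ v w : E, (b (e.symm y) : E →L[ℝ] E →L[ℝ] ℝ) v w =
      (b (e.symm y) : E →L[ℝ] E →L[ℝ] ℝ) w v)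
    (hp : ∀ v : E, v ≠ 0 → 0 < (b (e.symm y) : E →L[ℝ] E →L[ℝ] ℝ) v v) :
    IsInner (inChart e b y) where
  symm v w := by rw [inChart_apply he hy, inChart_apply he hy, hs]
  pos v hv := by
    rw [inChart_apply he hy]
    refine hp _ fun h0 => hv ?_
    exact (isInvertible_chartFrame he hy).injective (h0.trans (map_zero _).symm)

theorem inChart_fundamentalForm {e : OpenPartialHomeomorph M E} (he : e ∈ atlas E M) {y : E}
    (hy : y ∈ e.target) (b : BilinField E M) :
    inChart e (fundamentalForm b) y = (inChart e b y).comp (mulI E) := by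
  ext v w
  rw [ContinuousLinearMap.comp_apply, inChart_apply (mem_maximalAtlas_real he) hy,
    inChart_apply (mem_maximalAtlas_real he) hy, chartFrame_mulI he hy]
  rfl

variable [FiniteDimensional ℂ E]

/-- The Christoffel symbols of a Kähler metric in a holomorphic chart are complex linear. -/
theorem IsKahlerOn.christoffel_mulI {g : BilinField E M} {U : Set M} (hg : IsKahlerOn g U)
    {e : OpenPartialHomeomorph M E} (he : e ∈ atlas E M) (hU : IsOpen U) {z : E}
    (hz : z ∈ e.target) (hzU : e.symm z ∈ U) (v w : E) :
    christoffel (inChart e g) z v (mulI E w) = mulI E (christoffel (inChart e g) z v w) := by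
  have hr := mem_maximalAtlas_real he
  have hO : e.target ∩ e.symm ⁻¹' U ∈ nhds z :=
    (e.isOpen_inter_preimage_symm hU).mem_nhds ⟨hz, hzU⟩
  refine HermitianGeometry.christoffel_mulI
    (((hg.contDiffOn e he).contDiffAt hO).differentiableAt (by simp)) ?_ ?_ ?_ v w
  · filter_upwards [hO] with x hx
    exact isInner_inChart hr hx.1 (hg.symm _ hx.2) (hg.pos _ hx.2)
  · filter_upwards [hO] with x hx v w
    rw [inChart_apply hr hx.1, inChart_apply hr hx.1, chartFrame_mulI he hx.1,
      chartFrame_mulI he hx.1]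
    exact hg.invariant _ hx.2 _ _
  · intro u v w
    have h1 := hg.closed e he z ⟨hz, hzU⟩ u v w
    have hev : inChart e (fundamentalForm g) =ᶠ[nhds z] fun x => (inChart e g x).comp (mulI E) := by
      filter_upwards [hO] with x hx
      exact inChart_fundamentalForm he hx.1 g
    unfold coordExtDeriv at h1 ⊢
    rw [hev.fderiv_eq] at h1
    exact h1

end Charts

/-! ### The global theorem -/

section Global

variable {E : Type*} [NormedAddCommGroup E] [NormedSpace ℂ E] [FiniteDimensional ℂ E]
  {M : Type*} [TopologicalSpace M] [ChartedSpace E M] [IsManifold 𝓘(ℂ, E) ω M]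

/-- The complex structure read in a real chart `e`, through a change of coordinates to a holomorphic
chart `e'`. -/
noncomputable def coordJ (e e' : OpenPartialHomeomorph M E) (y : E) : E →L[ℝ] E :=
  (fderiv ℝ (e' ∘ e.symm) y).inverse.comp ((mulI E).comp (fderiv ℝ (e' ∘ e.symm) y))

/-- A conformal factor whose zero set is small has no zeros. -/
theorem conformalFactor_ne_zero {m : ℕ} (hm : 2 ≤ m) (hE : Module.finrank ℂ E = m)
    (h : Bundle.RiemannianMetric (fun x : M ↦ TangentSpace 𝓘(ℝ, E) x))
    (h_herm : IsJInvariantOn (E := E) (M := M) h.inner Set.univ)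
    {𝓑 : Set (OpenPartialHomeomorph M E)} (h𝓑 : IsC2CompatibleAtlas 𝓑)
    (h_reg : ∀ φ ∈ 𝓑, ContDiffOn ℝ 2 (inChart φ h.inner) φ.target)
    (h_ricci : ∀ φ ∈ 𝓑, ∀ x ∈ φ.source, ∀ v w : TangentSpace 𝓘(ℝ, E) x,
      ricci φ h.inner x (complexStructure x v) (complexStructure x w) = ricci φ h.inner x v w)
    {f : M → ℝ} (f_cont : Continuous f)
    (f_reg : ContMDiffOn 𝓘(ℝ, E) 𝓘(ℝ, ℝ) 2 f {x | f x ≠ 0})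
    (h_kahler : IsKahlerOn (conformalChange f h.inner) {x | f x ≠ 0})
    (h_dim : hausdorffDim E {x : M | f x = 0} < ((2 * m - 1 : ℕ) : ENNReal)) (p : M) :
    f p ≠ 0 := by
  obtain ⟨ψ, hψ, hpψ⟩ := h𝓑.covers p
  have hψr := h𝓑.compatible hψ
  set φ := chartAt E p with hφ_def
  have hφ : φ ∈ atlas E M := chart_mem_atlas E p
  have hφr := mem_maximalAtlas_real hφ
  have hpφ : p ∈ φ.source := mem_chart_source E p
  have hY : IsOpen {x : M | f x ≠ 0} := isOpen_ne.preimage f_cont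
  have hrank : Module.finrank ℝ E = 2 * m := by rw [finrank_real_of_complex, hE]
  set σ := ψ.symm ≫ₕ φ with hσ
  have hsrc : ∀ y, y ∈ σ.source ↔ y ∈ ψ.target ∧ ψ.symm y ∈ φ.source := by intro y; simp [hσ]
  have hpσ : ψ p ∈ σ.source := (hsrc _).2 ⟨ψ.map_source hpψ, by rwa [ψ.left_inv hpψ]⟩
  -- A neighbourhood of `ψ p` which the change of coordinates maps into a ball.
  obtain ⟨r, hr, hball⟩ := Metric.isOpen_iff.1 σ.open_target _ (σ.map_source hpσ)
  set W := Metric.ball (σ (ψ p)) r with hW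
  set U := σ.source ∩ σ ⁻¹' W with hU
  have hUo : IsOpen U := σ.isOpen_inter_preimage Metric.isOpen_ball
  have hpU : ψ p ∈ U := ⟨hpσ, Metric.mem_ball_self hr⟩
  have hUψ : ∀ y ∈ U, y ∈ ψ.target := fun y hy => ((hsrc y).1 hy.1).1
  have hUφ : ∀ y ∈ U, ψ.symm y ∈ φ.source := fun y hy => ((hsrc y).1 hy.1).2
  set τ : E → E := φ ∘ ψ.symm with hτ_def
  have hτ : ∀ y ∈ U, ContDiffAt ℝ 2 τ y := fun y hy =>
    (contDiffOn_transition hψr hφr).contDiffAt (σ.open_source.mem_nhds hy.1)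
  have hT : ∀ y ∈ U, (fderiv ℝ τ y).IsInvertible := fun y hy =>
    isInvertible_fderiv_transition hψr hφr hy.1
  have hTJ : ∀ y ∈ U, ∀ v, fderiv ℝ τ y (coordJ ψ φ y v) = mulI E (fderiv ℝ τ y v) :=
    fun y hy v => (hT y hy).self_apply_inverse _
  have hAJ : ∀ y ∈ U, ∀ v, chartFrame ψ y (coordJ ψ φ y v) = mulI E (chartFrame ψ y v) := by
    intro y hy v
    rw [chartFrame_comp hψr hφr hy.1, ContinuousLinearMap.comp_apply,
      ContinuousLinearMap.comp_apply, hTJ y hy, chartFrame_mulI hφ (φ.map_source (hUφ y hy))]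
  have hJC : ∀ y ∈ U, ContDiffAt ℝ 1 (coordJ ψ φ) y := by
    intro y hy
    have hD : ContDiffAt ℝ 1 (fderiv ℝ τ) y := (hτ y hy).fderiv_right (by norm_num)
    exact (contDiffAt_clm_inverse hD (hT y hy)).clm_comp (contDiffAt_const.clm_comp hD)
  have hGi : ∀ y ∈ U, IsInner (inChart ψ h.inner y) := fun y hy =>
    isInner_inChart hψr (hUψ y hy) (h.symm _) (h.pos _)
  have hfC : ∀ y ∈ U, f (ψ.symm y) ≠ 0 → ContDiffAt ℝ 2 (f ∘ ψ.symm) y := by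
    intro y hy hy0
    rw [← contMDiffAt_iff_contDiffAt]
    exact (f_reg.contMDiffAt (hY.mem_nhds hy0)).comp y
      ((contMDiffOn_symm_of_mem_maximalAtlas hψr).contMDiffAt (ψ.open_target.mem_nhds (hUψ y hy)))
  have hGC : ContDiffOn ℝ 2 (inChart ψ h.inner) U := (h_reg ψ hψ).mono hUψ
  have key := ne_zero_of_parallel (U := U) (G := inChart ψ h.inner) (J := coordJ ψ φ)
    (f := f ∘ ψ.symm) (p := ψ p) (by omega) hUo hGi hGC
    (fun y hy => (hJC y hy).contDiffWithinAt) ?_ ?_ ?_ ?_ hfC ?_ ?_ hpU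
  · simpa [ψ.left_inv hpψ] using key
  · intro y hy v
    refine (hT y hy).injective ?_
    rw [hTJ y hy, hTJ y hy, mulI_mulI, map_neg]
  · intro y hy v w
    rw [inChart_apply hψr (hUψ y hy), inChart_apply hψr (hUψ y hy), hAJ y hy, hAJ y hy]
    exact h_herm _ (Set.mem_univ _) _ _
  · intro y hy v w
    have hyψ := hUψ y hy
    have hmd : ψ.MDifferentiable 𝓘(ℝ, E) 𝓘(ℝ, E) :=
      ⟨(contMDiffOn_of_mem_maximalAtlas hψr).mdifferentiableOn (by simp),
        (contMDiffOn_symm_of_mem_maximalAtlas hψr).mdifferentiableOn (by simp)⟩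
    have hB : ∀ u : E, (mfderiv 𝓘(ℝ, E) 𝓘(ℝ, E) ψ (ψ.symm y) : E →L[ℝ] E) (chartFrame ψ y u) = u := by
      intro u
      rw [← mfderiv_symm_eq_chartFrame hψr hyψ]
      exact congrArg (fun L : E →L[ℝ] E => L u) (hmd.comp_symm_deriv hyψ)
    have hR : ∀ u u' : E, ricci ψ h.inner (ψ.symm y) (chartFrame ψ y u) (chartFrame ψ y u') =
        coordRicci (inChart ψ h.inner) y u u' := by
      intro u u'
      have h1 : ricci ψ h.inner (ψ.symm y) (chartFrame ψ y u) (chartFrame ψ y u') =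
        coordRicci (inChart ψ h.inner) (ψ (ψ.symm y))
          ((mfderiv 𝓘(ℝ, E) 𝓘(ℝ, E) ψ (ψ.symm y) : E →L[ℝ] E) (chartFrame ψ y u))
          ((mfderiv 𝓘(ℝ, E) 𝓘(ℝ, E) ψ (ψ.symm y) : E →L[ℝ] E) (chartFrame ψ y u')) := rfl
      rw [h1, hB, hB, ψ.right_inv hyψ]
    rw [← hR, ← hR, hAJ y hy, hAJ y hy]
    exact h_ricci ψ hψ _ (ψ.map_target hyψ) _ _
  · exact f_cont.comp_continuousOn (ψ.continuousOn_symm.mono hUψ)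
  · intro y hy hy0
    have hzt : τ y ∈ φ.target := φ.map_source (hUφ y hy)
    have hzs : φ.symm (τ y) = ψ.symm y := φ.left_inv (hUφ y hy)
    have hz0 : φ.symm (τ y) ∈ {x : M | f x ≠ 0} := by rw [hzs]; exact hy0
    have hO : φ.target ∩ φ.symm ⁻¹' {x : M | f x ≠ 0} ∈ nhds (τ y) :=
      (φ.isOpen_inter_preimage_symm hY).mem_nhds ⟨hzt, hz0⟩
    have hUy := hUo.mem_nhds hy
    refine fderiv_complexStructure_eq (hτ y hy) (hT y hy)
      (gc := inChart φ (conformalChange f h.inner))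
      (((h_kahler.contDiffOn φ hφ).contDiffAt hO).differentiableAt (by simp)) ?_ ?_ ?_ ?_
      ((hJC y hy).differentiableAt (by simp)) ?_
      (h_kahler.christoffel_mulI hφ hY hzt hz0)
    · filter_upwards [hO] with x hx
      exact isInner_inChart hφr hx.1 (h_kahler.symm _ hx.2) (h_kahler.pos _ hx.2)
    · exact ((((hfC y hy hy0).pow 2).smul (hGC.contDiffAt hUy)).differentiableAt (by simp))
    · exact (hGi y hy).smul_sq hy0
    · filter_upwards [hUy] with x hx v w
      refine Eq.trans ?_ (inChart_transition hψr hφr hx.1 (conformalChange f h.inner) v w)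
      simp only [smul_apply, inChart_apply hψr (hUψ x hx)]
      rfl
    · filter_upwards [hUy] with x hx using hTJ x hx
  · rw [hrank]
    refine lt_of_le_of_lt ?_ h_dim
    have hsub : U ∩ {y | (f ∘ ψ.symm) y = 0} ⊆
        (ψ ∘ φ.symm) '' (W ∩ φ '' (φ.source ∩ {x | f x = 0})) := by
      rintro y ⟨hy, hy0⟩
      refine ⟨τ y, ⟨hy.2, ψ.symm y, ⟨hUφ y hy, hy0⟩, rfl⟩, ?_⟩
      simp only [hτ_def, Function.comp_apply, φ.left_inv (hUφ y hy), ψ.right_inv (hUψ y hy)]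
    have hC : ContDiffOn ℝ 1 (ψ ∘ φ.symm) W := by
      refine ((contDiffOn_transition hφr hψr).of_le (by norm_num)).mono fun z hz => ?_
      have := hball hz
      simpa [hσ, and_comm] using this
    calc dimH (U ∩ {y | (f ∘ ψ.symm) y = 0})
        ≤ dimH ((ψ ∘ φ.symm) '' (W ∩ φ '' (φ.source ∩ {x | f x = 0}))) := dimH_mono hsub
      _ ≤ dimH (W ∩ φ '' (φ.source ∩ {x | f x = 0})) :=
          hC.dimH_image_le (convex_ball _ _) Set.inter_subset_left
      _ ≤ dimH (φ '' (φ.source ∩ {x | f x = 0})) := dimH_mono Set.inter_subset_right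
      _ ≤ hausdorffDim E {x : M | f x = 0} :=
          le_iSup₂ (f := fun φ (_ : φ ∈ atlas E M) => dimH (φ '' (φ.source ∩ {x : M | f x = 0}))) φ hφ

end Global

end HermitianGeometry

theorem mainTheorem6 {E : Type*} [NormedAddCommGroup E] [NormedSpace ℂ E] [FiniteDimensional ℂ E]
    {M : Type*} [TopologicalSpace M] [T2Space M] [ChartedSpace E M] [IsManifold 𝓘(ℂ, E) ω M]
    (m : ℕ) (hm : 2 ≤ m) (hE : Module.finrank ℂ E = m)
    (h : Bundle.RiemannianMetric (fun x : M ↦ TangentSpace 𝓘(ℝ, E) x))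
    (h_herm : HermitianGeometry.IsJInvariantOn (E := E) (M := M) h.inner Set.univ)
    (𝓑 : Set (OpenPartialHomeomorph M E))
    (h𝓑 : HermitianGeometry.IsC2CompatibleAtlas 𝓑)
    (h_reg : ∀ φ ∈ 𝓑, ContDiffOn ℝ 3 (HermitianGeometry.inChart φ h.inner) φ.target)
    (h_ricci : ∀ φ ∈ 𝓑, ∀ x ∈ φ.source, ∀ v w : TangentSpace 𝓘(ℝ, E) x,
      HermitianGeometry.ricci φ h.inner x (HermitianGeometry.complexStructure x v)
          (HermitianGeometry.complexStructure x w) =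
        HermitianGeometry.ricci φ h.inner x v w)
    (f : M → ℝ) (f_cont : Continuous f) (f_nonneg : ∀ x, 0 ≤ f x)
    (f_reg : ContMDiffOn 𝓘(ℝ, E) 𝓘(ℝ, ℝ) 2 f {x | f x ≠ 0})
    (h_kahler : HermitianGeometry.IsKahlerOn
      (HermitianGeometry.conformalChange f h.inner) {x | f x ≠ 0})
    (h_dim : HermitianGeometry.hausdorffDim E {x : M | f x = 0} < ((2 * m - 1 : ℕ) : ENNReal)) :
    {x : M | f x = 0} = ∅ ∧ (∀ x, 0 < f x) ∧
      HermitianGeometry.IsGloballyConformallyKahler (E := E) (M := M) h.inner := by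
  have h0 : ∀ x, f x ≠ 0 := HermitianGeometry.conformalFactor_ne_zero hm hE h h_herm h𝓑
    (fun φ hφ => (h_reg φ hφ).of_le (by norm_num)) h_ricci f_cont f_reg h_kahler h_dim
  have hpos : ∀ x, 0 < f x := fun x => lt_of_le_of_ne (f_nonneg x) (h0 x).symm
  have huniv : {x : M | f x ≠ 0} = Set.univ := Set.eq_univ_of_forall h0
  rw [huniv] at f_reg h_kahler
  exact ⟨Set.eq_empty_of_forall_notMem h0, hpos, f, hpos, contMDiffOn_univ.1 f_reg, h_kahler⟩
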